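/- For $\alpha,\beta>0$ with $\alpha+\beta<1$, let $T=T_{\alpha,\beta}$ be the three-interval exchange on $[0,1)$ given by $Tx=x+1-\alpha$ on $X_1=[0,\alpha)$, $Tx=x+1-2\alpha-\beta$ on $X_2=[\alpha,\alpha+\beta)$, $Tx=x-\alpha-\beta$ on $X_3=[\alpha+\beta,1)$. It satisfies the i.d.o.c. condition if none of the relations $p\alpha+q\beta=p-q$, $p\alpha+q\beta=p-q+1$, $p\alpha+q\beta=p-q-1$ holds with integers $(p,q)\neq(0,0)$. The trajectory of $x\in[0,1)$ is the sequence $(x_n)_{n\ge0}$ with $x_n=i$ if $T^nx\in X_i$; $L(T)$ is the set of all finite factors of trajectories. The natural coding of $T$ is the one-sided shift $S$ on the set $X_{L(T)}$ of the sequences $(x_n)_{n\ge 0}\in\{1,2,3\}^{\mathbb N}$ such that $x_r\cdots x_s\in L(T)$ for all $r<s$. If this system is uniquely ergodic, with $S$-invariant probability measure $\mu$, let $e_n$ be the smallest positive value of $\mu[w]$ over the words $w\in L(T)$ of length $n$, where $[w]$ is the set of points of $X_{L(T)}$ beginning with $w$, and let $$\mathcal B(T)=\limsup_{n\to+\infty}\frac1{n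 e_n}\in[0,+\infty].$$ **Theorem.** For every $b\in[12+2\sqrt2,+\infty]$ there is a three-interval exchange $T=T_{\alpha,\beta}$ which satisfies the i.d.o.c. condition, whose natural coding is uniquely ergodic, and for which $\mathcal B(T)=b$. In other words, the upper BL spectrum of the family of three-interval exchanges contains $[12+2\sqrt2,+\infty]$. The same holds for the subfamily of those with $\alpha<\frac12$ and $2\alpha+\beta>1$. -/

import Mathlib

open MeasureTheory Filter Set
open scoped ENNReal

namespace BL

/-! ### Symbolic systems -/

section Symbolic

variable {A : Type*}

/-- The word `x_r x_{r+1} ... x_{r+n-1}` of length `n` occurring at position `r` in `x`. -/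
def factor (x : ℕ → A) (r n : ℕ) : List A := List.ofFn fun i : Fin n => x (r + i)

/-- The one-sided shift `x_0 x_1 x_2 ... ↦ x_1 x_2 ...`. -/
def shift (x : ℕ → A) : ℕ → A := fun n => x (n + 1)

/-- The space `X_L`: the infinite sequences such that `x_r ... x_s` is in `L` for all `r < s`. -/
def symbolicSpace (L : Language A) : Set (ℕ → A) :=
  {x | ∀ r s : ℕ, r < s → factor x r (s - r + 1) ∈ L}

/-- The cylinder `[w]`: the points of `X_L` which begin with the word `w`. -/
def cylinder (L : Language A) (w : List A) : Set (ℕ → A) :=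
  {x | x ∈ symbolicSpace L ∧ factor x 0 w.length = w}

variable [MeasurableSpace A]

/-- `μ` is a shift-invariant probability measure on `X_L`, seen as a measure on the space of all
sequences which is carried by `X_L`. -/
structure IsInvariantProbability (L : Language A) (μ : Measure (ℕ → A)) : Prop where
  isProbabilityMeasure : IsProbabilityMeasure μ
  carried : ∀ᵐ x ∂μ, x ∈ symbolicSpace L
  invariant : MeasurePreserving shift μ μ

/-- `(X_L, S)` is uniquely ergodic and `μ` is its only invariant probability measure. -/
def IsUniqueInvariantProbability (L : Language A) (μ : Measure (ℕ → A)) : Prop :=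
  IsInvariantProbability L μ ∧ ∀ ν : Measure (ℕ → A), IsInvariantProbability L ν → ν = μ

/-- `e_n(μ)`: the smallest positive frequency `μ[w]` of the words `w` of length `n` of `L`
(over a finite alphabet the infimum is over a finite set). -/
noncomputable def minFrequency (L : Language A) (μ : Measure (ℕ → A)) (n : ℕ) : ℝ≥0∞ :=
  sInf {f | 0 < f ∧ ∃ w ∈ L, w.length = n ∧ μ (cylinder L w) = f}

/-- `limsup 1 / (n e_n)`, a value in `[0, +∞]`. -/
noncomputable def upperB (L : Language A) (μ : Measure (ℕ → A)) : ℝ≥0∞ :=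
  limsup (fun n : ℕ => 1 / ((n : ℝ≥0∞) * minFrequency L μ n)) atTop

/-- The upper BL spectrum of a family of symbolic systems (given by their languages): all the
values of `limsup 1 / (n e_n)`, where `e_n` is computed with the unique invariant probability. -/
def upperBLSpectrum (F : Set (Language A)) : Set ℝ≥0∞ :=
  {b | ∃ L ∈ F, ∃ μ : Measure (ℕ → A), IsUniqueInvariantProbability L μ ∧ upperB L μ = b}

end Symbolic

/-! ### Three-interval exchanges -/

/-- The three-interval exchange `T` on `[0, 1)` (values outside `[0, 1)` are irrelevant). -/
noncomputable def exchange (α β x : ℝ) : ℝ :=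
  if x < α then x + 1 - α
  else if x < α + β then x + 1 - 2 * α - β
  else x - α - β

/-- The partition of `[0, 1)` into `[0, α)`, `[α, α + β)`, `[α + β, 1)`, with letters
`0`, `1`, `2`. -/
noncomputable def letter (α β x : ℝ) : Fin 3 :=
  if x < α then 0 else if x < α + β then 1 else 2

/-- The trajectory of `x` under `T`. -/
noncomputable def trajectory (α β x : ℝ) : ℕ → Fin 3 :=
  fun n => letter α β ((exchange α β)^[n] x)

/-- The language `L(T)`: all finite factors of the trajectories of the points of `[0, 1)`. -/
def exchangeLanguage (α β : ℝ) : Language (Fin 3) :=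
  {w | ∃ x ∈ Ico (0 : ℝ) 1, ∃ r n : ℕ, w = factor (trajectory α β x) r n}

/-- The i.d.o.c. condition: no rational relation `p α + q β = p - q`, `p - q + 1` or `p - q - 1`,
apart from the empty relation `0 = 0`. -/
def IDOC (α β : ℝ) : Prop :=
  ∀ p q : ℤ, (p, q) ≠ (0, 0) →
    p * α + q * β ≠ p - q ∧ p * α + q * β ≠ p - q + 1 ∧ p * α + q * β ≠ p - q - 1

/-- The natural codings of all three-interval exchanges with the i.d.o.c. condition. -/
def threeIntervalExchanges : Set (Language (Fin 3)) :=
  {L | ∃ α β : ℝ, 0 < α ∧ 0 < β ∧ α + β < 1 ∧ IDOC α β ∧ L = exchangeLanguage α β}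

/-- The natural codings of the three-interval exchanges with the i.d.o.c. condition and
`α < 1 / 2`, `2 α + β > 1`. -/
def restrictedThreeIntervalExchanges : Set (Language (Fin 3)) :=
  {L | ∃ α β : ℝ, 0 < α ∧ 0 < β ∧ α + β < 1 ∧ IDOC α β ∧ α < 1 / 2 ∧ 1 < 2 * α + β ∧
    L = exchangeLanguage α β}

end BL

open MeasureTheory Filter Set
open scoped ENNReal

namespace BL

/-! ### Uniform equidistribution of irrational rotations -/

/-! Dynamics. The exchange is the first return to `[0, 1)` of the rotation by `1 - α` on a circle of
length `1 + β` (`exchange_eq`, `hits_rot`). Irrational rotations equidistribute uniformly in the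
starting point, so the natural coding is uniquely ergodic, frequencies of words are lengths of
cells, and `n` steps make about `n (1 - α)` turns. Ends of cells come from the discontinuities, so a
length has the form `N (1 - α) - l (1 + β) + τ β` with `τ ∈ {-1, 0, 1}` and `|l|` at most about `n
(1 - α)`. Thus `limsup 1 / (n e_n)` is governed by the products of `|l|` with such forms: lower
bounds for the products bound it above (`upperB_le`), and good approximations with `τ = -1` bound it
below (`le_upperB`).

Diophantine approximation. The parameters are read off a two-sided inhomogeneous continued fraction
with digits `(a, g)`. After doubling, the pairs `(l, N)` become pairs `p` of odd integers, and `4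
|l| |form| / (1 - α)` is `|Q|`, where `Q` is a left form times a right form. `Recursion.product_eq`
computes the same `Q` at every level, the integer point being moved by `orbit`. At the first level
where the second coordinate dominates, `Q` can be bounded below. Away from special digits this gives
`|Q| ≥ 27/100`, hence values `4 / |Q| ≤ 400/27 < 12 + 2√2`. A special digit `(A, 4 - A)` between
`(-6, 0)` and `(6, 0)` is designed so that the point `(3, -1)` gives `(2 + S) T / (A - x - y)`, with
`S = leftCoef` and `T = rightCoef`, and no competing point gives less (`inhomogeneous_bound`).
Homogeneous products contribute at most about `A + 1`, which is smaller. So the limsup is read on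
the values `4 (A - x - y) / ((2 + S) T)`.

Prescribing the value. Letting `A` tend to infinity gives `+∞`. For finite `b`, one `A` is used at
sparse places, preceded by longer and longer runs of `(-6, 0)` and followed by longer and longer
prefixes of one infinite word. On the left, `x → c = -3 + 2√2` and `d → 0`, so `4 (A - c - y) = b (6
- 2√2) (1 - y + e)` has to hold in the limit. This is a linear relation `e + κ y = r₀` on the right
tail. Reading a digit turns it into a relation of the same kind; since the tails contract, it is
enough to choose normal digits that keep its coefficients bounded, and `cover` shows that this is
always possible. The hypothesis `b ≥ 12 + 2√2` leaves room for an integer `A` that starts the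
process. -/

lemma indicator_fract_eq {t : ℝ} (ht0 : 0 ≤ t) (ht1 : t < 1) (u : ℝ) :
    (Ico 0 t).indicator (fun _ => (1 : ℝ)) (Int.fract u) =
      t - Int.fract u + Int.fract (u - t) := by
  have h0 := Int.fract_nonneg u
  have h1 := Int.fract_lt_one u
  by_cases h : Int.fract u < t
  · rw [indicator_of_mem (show Int.fract u ∈ Ico 0 t from ⟨h0, h⟩)]
    have : Int.fract (u - t) = Int.fract u - t + 1 := by
      rw [Int.fract_eq_iff]
      refine ⟨by linarith, by linarith, ⌊u⌋ - 1, ?_⟩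
      push_cast
      rw [Int.fract]; ring
    rw [this]; ring
  · rw [indicator_of_notMem (fun hh => h hh.2)]
    have : Int.fract (u - t) = Int.fract u - t := by
      rw [Int.fract_eq_iff]
      refine ⟨by linarith, by linarith, ⌊u⌋, ?_⟩
      rw [Int.fract]; ring
    rw [this]; ring

lemma abs_sum_fract_sub_nat_mul_le (θ y : ℝ) (N m : ℕ) :
    |∑ k ∈ Finset.range N, (Int.fract (y + k * θ - m * θ) - Int.fract (y + k * θ))| ≤ m := by
  induction m with
  | zero => simp
  | succ m ih =>
    have h : ∑ k ∈ Finset.range N,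
        (Int.fract (y + k * θ - (m + 1 : ℕ) * θ) - Int.fract (y + k * θ - m * θ)) =
        Int.fract (y - (m + 1) * θ) - Int.fract (y + N * θ - (m + 1) * θ) := by
      have := Finset.sum_range_sub' (fun k : ℕ => Int.fract (y + k * θ - (m + 1) * θ)) N
      simp only [Nat.cast_zero, zero_mul, add_zero] at this
      rw [← this]
      refine Finset.sum_congr rfl fun k _ => ?_
      push_cast
      congr 2
      ring
    have h' : |∑ k ∈ Finset.range N,
        (Int.fract (y + k * θ - (m + 1 : ℕ) * θ) - Int.fract (y + k * θ - m * θ))| ≤ 1 := by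
      rw [h, abs_le]
      constructor <;>
      linarith [Int.fract_nonneg (y - (m + 1) * θ), Int.fract_lt_one (y - (m + 1) * θ),
        Int.fract_nonneg (y + N * θ - (m + 1) * θ), Int.fract_lt_one (y + N * θ - (m + 1) * θ)]
    calc _ = |∑ k ∈ Finset.range N,
        (Int.fract (y + k * θ - (m + 1 : ℕ) * θ) - Int.fract (y + k * θ - m * θ)) +
        ∑ k ∈ Finset.range N, (Int.fract (y + k * θ - m * θ) - Int.fract (y + k * θ))| := by
          rw [← Finset.sum_add_distrib]
          congr 1
          exact Finset.sum_congr rfl fun k _ => by ring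
      _ ≤ 1 + m := (abs_add_le _ _).trans (add_le_add h' ih)
      _ = _ := by push_cast; ring

lemma abs_sum_fract_sub_int_mul_le (θ y : ℝ) (N : ℕ) (m : ℤ) :
    |∑ k ∈ Finset.range N, (Int.fract (y + k * θ - m * θ) - Int.fract (y + k * θ))| ≤ |(m : ℝ)| := by
  obtain ⟨n, rfl | rfl⟩ := m.eq_nat_or_neg
  · simpa using abs_sum_fract_sub_nat_mul_le θ y N n
  · have := abs_sum_fract_sub_nat_mul_le θ (y + n * θ) N n
    rw [← abs_neg, ← Finset.sum_neg_distrib] at this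
    refine le_trans (le_of_eq ?_) (this.trans (by simp))
    congr 1
    refine Finset.sum_congr rfl fun k _ => ?_
    push_cast
    rw [neg_sub]
    congr 2 <;> ring

/-- The number of points of an orbit segment of a sequence which lie in `[a, b)`. -/
noncomputable def hits (u : ℕ → ℝ) (a b : ℝ) (N : ℕ) : ℝ :=
  ∑ k ∈ Finset.range N, (Ico a b).indicator (fun _ => (1 : ℝ)) (u k)

lemma hits_nonneg (u : ℕ → ℝ) (a b : ℝ) (N : ℕ) : 0 ≤ hits u a b N :=
  Finset.sum_nonneg fun _ _ => indicator_nonneg (fun _ _ => zero_le_one) _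

lemma hits_le (u : ℕ → ℝ) (a b : ℝ) (N : ℕ) : hits u a b N ≤ N := by
  calc hits u a b N ≤ ∑ k ∈ Finset.range N, (1 : ℝ) :=
        Finset.sum_le_sum fun _ _ => indicator_le_self' (fun _ _ => zero_le_one) _
    _ = N := by simp

lemma hits_mono (u : ℕ → ℝ) {a b b' : ℝ} (h : b ≤ b') (N : ℕ) : hits u a b N ≤ hits u a b' N :=
  Finset.sum_le_sum fun _ _ =>
    indicator_le_indicator_of_subset (Ico_subset_Ico_right h) (fun _ => zero_le_one) _

lemma hits_add (u : ℕ → ℝ) {a b c : ℝ} (h : a ≤ b) (h' : b ≤ c) (N : ℕ) :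
    hits u a b N + hits u b c N = hits u a c N := by
  rw [hits, hits, hits, ← Finset.sum_add_distrib]
  refine Finset.sum_congr rfl fun k _ => ?_
  rw [← Ico_union_Ico_eq_Ico h h', indicator_union_of_disjoint (by simp)]

/-- The indicator of an arc of length `{mθ}` minus its mean is a coboundary of the rotation, so the
sums telescope to a bound that depends neither on `N` nor on `y`. -/
lemma abs_hits_fract_sub_le (θ y : ℝ) (m : ℤ) (N : ℕ) :
    |hits (fun k => Int.fract (y + k * θ)) 0 (Int.fract (m * θ)) N - N * Int.fract (m * θ)| ≤
      |(m : ℝ)| := by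
  refine le_trans (le_of_eq ?_) (abs_sum_fract_sub_int_mul_le θ y N m)
  congr 1
  rw [hits, show (N : ℝ) * Int.fract (m * θ) = ∑ k ∈ Finset.range N, Int.fract (m * θ) by simp,
    ← Finset.sum_sub_distrib]
  refine Finset.sum_congr rfl fun k _ => ?_
  rw [indicator_fract_eq (Int.fract_nonneg _) (Int.fract_lt_one _)]
  have : Int.fract (y + k * θ - Int.fract (m * θ)) = Int.fract (y + k * θ - m * θ) := by
    rw [Int.fract_eq_fract]
    exact ⟨⌊m * θ⌋, by rw [Int.fract]; ring⟩
  rw [this]; ring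

lemma exists_fract_mul_mem_Ioo {θ : ℝ} (hθ : Irrational θ) {a b : ℝ} (ha : 0 ≤ a) (hab : a < b)
    (hb : b ≤ 1) : ∃ m : ℤ, Int.fract (m * θ) ∈ Ioo a b := by
  have hd : Dense (AddSubgroup.closure {θ, 1} : Set ℝ) :=
    dense_addSubgroupClosure_pair_iff.2 (by simpa using hθ)
  obtain ⟨x, hx, hx'⟩ := hd.exists_mem_open isOpen_Ioo (nonempty_Ioo.2 hab)
  obtain ⟨m, n, rfl⟩ := AddSubgroup.mem_closure_pair.1 hx
  refine ⟨m, ?_⟩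
  have : Int.fract (m * θ) = m • θ + n • (1 : ℝ) := by
    rw [Int.fract_eq_iff]
    refine ⟨ha.trans hx'.1.le, hx'.2.trans_le hb, -n, ?_⟩
    simp
  rw [this]
  exact hx'

/-- By density there is a length `{mθ}` in each cell of a grid of mesh `1 / M`, and `[0, t)` is
squeezed between two such arcs, or treated trivially near the ends. Only finitely many `m` occur,
which gives uniformity in `y` and `t`. -/
theorem rotation_equidistribution_zero {θ : ℝ} (hθ : Irrational θ) {ε : ℝ} (hε : 0 < ε) :
    ∃ N₀ : ℕ, ∀ N ≥ N₀, ∀ y t : ℝ, 0 ≤ t → t ≤ 1 →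
      |hits (fun k => Int.fract (y + k * θ)) 0 t N - N * t| ≤ ε * N := by
  obtain ⟨M, hM⟩ := exists_nat_gt (4 / ε)
  have hM0 : (0 : ℝ) < M := lt_trans (by positivity) hM
  have hMε : 4 < ε * M := by rwa [div_lt_iff₀ hε, mul_comm] at hM
  have key : ∀ i : ℕ, ∃ m : ℤ, i < M → Int.fract (m * θ) ∈ Ioo ((i : ℝ) / M) ((i + 1) / M) := by
    intro i
    by_cases hi : i < M
    · obtain ⟨m, hm⟩ := exists_fract_mul_mem_Ioo hθ (a := (i : ℝ) / M) (b := (i + 1) / M)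
        (by positivity) (by gcongr; linarith)
        (by rw [div_le_one hM0]; exact_mod_cast hi)
      exact ⟨m, fun _ => hm⟩
    · exact ⟨0, fun h => absurd h hi⟩
  choose m hm using key
  obtain ⟨K, hK⟩ : ∃ K : ℕ, ∀ i < M, |(m i : ℝ)| ≤ K := by
    refine ⟨∑ i ∈ Finset.range M, (m i).natAbs, fun i hi => ?_⟩
    have : (m i).natAbs ≤ ∑ i ∈ Finset.range M, (m i).natAbs :=
      Finset.single_le_sum (f := fun i => (m i).natAbs) (fun _ _ => Nat.zero_le _)
        (Finset.mem_range.2 hi)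
    rw [← Int.cast_abs, Int.abs_eq_natAbs, Int.cast_natCast]
    exact_mod_cast this
  obtain ⟨N₀, hN₀⟩ := exists_nat_gt (2 * K / ε)
  refine ⟨N₀, fun N hN y t ht0 ht1 => ?_⟩
  have hNK : 2 * (K : ℝ) ≤ ε * N := by
    have : 2 * (K : ℝ) / ε ≤ N := hN₀.le.trans (by exact_mod_cast hN)
    rw [div_le_iff₀ hε] at this
    linarith
  have hN0 : (0 : ℝ) ≤ N := Nat.cast_nonneg N
  set u : ℕ → ℝ := fun k => Int.fract (y + k * θ)
  have hstep : ∀ i < M, |hits u 0 (Int.fract (m i * θ)) N - N * Int.fract (m i * θ)| ≤ K :=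
    fun i hi => (abs_hits_fract_sub_le θ y (m i) N).trans (hK i hi)
  have hsmall : 2 / (M : ℝ) ≤ ε / 2 := by
    rw [div_le_div_iff₀ hM0 two_pos]; linarith
  set i := ⌊t * M⌋₊ with hi
  have hi1 : (i : ℝ) ≤ t * M := Nat.floor_le (by positivity)
  have hi2 : t * M < i + 1 := Nat.lt_floor_add_one _
  have htl : (i : ℝ) / M ≤ t := by rwa [div_le_iff₀ hM0]
  have htu : t < ((i : ℝ) + 1) / M := by rwa [lt_div_iff₀ hM0]
  rw [abs_le]
  constructor
  · rcases Nat.eq_zero_or_pos i with h0 | h0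
    · have h1 : t ≤ ε / 2 := by
        rw [h0] at htu
        have : ((0 : ℕ) + 1 : ℝ) / M ≤ 2 / M := by
          gcongr; norm_num
        linarith
      have := hits_nonneg u 0 t N
      nlinarith
    · obtain ⟨l, hl⟩ : ∃ l, i = l + 1 := ⟨i - 1, by omega⟩
      have hlM : l < M := by
        have : (i : ℝ) ≤ M := hi1.trans (by nlinarith)
        have : i ≤ M := by exact_mod_cast this
        omega
      have h1 := hm l hlM
      have h2 := (abs_le.1 (hstep l hlM)).1
      have h3 : Int.fract (m l * θ) ≤ t := by
        refine h1.2.le.trans (le_trans (le_of_eq ?_) htl)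
        rw [hl]; push_cast; rfl
      have h4 := hits_mono u (a := 0) h3 N
      have h5 : t - 2 / M ≤ Int.fract (m l * θ) := by
        refine le_trans ?_ h1.1.le
        have : ((i : ℝ) + 1) / M - 2 / M = l / M := by
          rw [hl]; push_cast; ring
        linarith
      nlinarith
  · rcases Nat.lt_or_ge (i + 1) M with h0 | h0
    · have h1 := hm (i + 1) h0
      have h2 := (abs_le.1 (hstep (i + 1) h0)).2
      push_cast at h1
      have h3 : t ≤ Int.fract (m (i + 1) * θ) := htu.le.trans h1.1.le
      have h4 := hits_mono u (a := 0) h3 N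
      have h5 : Int.fract (m (i + 1) * θ) ≤ t + 2 / M := by
        refine h1.2.le.trans ?_
        have : ((i : ℝ) + 1 + 1) / M = i / M + 2 / M := by ring
        linarith
      nlinarith
    · have h1 : 1 - 2 / M ≤ t := by
        have : (M : ℝ) ≤ i + 1 := by exact_mod_cast h0
        refine le_trans ?_ htl
        rw [sub_le_iff_le_add, ← add_div, le_div_iff₀ hM0]
        linarith
      have := hits_le u 0 t N
      nlinarith

theorem rotation_equidistribution {θ : ℝ} (hθ : Irrational θ) {ε : ℝ} (hε : 0 < ε) :
    ∃ N₀ : ℕ, ∀ N ≥ N₀, ∀ y a b : ℝ, 0 ≤ a → a ≤ b → b ≤ 1 →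
      |hits (fun k => Int.fract (y + k * θ)) a b N - N * (b - a)| ≤ ε * N := by
  obtain ⟨N₀, h⟩ := rotation_equidistribution_zero hθ (half_pos hε)
  refine ⟨N₀, fun N hN y a b ha hab hb => ?_⟩
  have h1 := abs_le.1 (h N hN y a ha (hab.trans hb))
  have h2 := abs_le.1 (h N hN y b (ha.trans hab) hb)
  have h3 := hits_add (fun k => Int.fract (y + k * θ)) ha hab N
  rw [abs_le]
  constructor <;> nlinarith

/-! ### Three-interval exchanges as induced maps of rotations -/

/-- The parameters of a three-interval exchange with the i.d.o.c. condition. -/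
structure Admissible (α β : ℝ) : Prop where
  left_pos : 0 < α
  mid_pos : 0 < β
  sum_lt : α + β < 1
  idoc : IDOC α β

/-- The number of steps of the rotation by `1 - α` modulo `1 + β` in one step of the exchange. -/
def rotTime (i : Fin 3) : ℕ := if i = 1 then 2 else 1

/-- The number of turns around the circle of length `1 + β` in one step of the exchange. -/
def turn (i : Fin 3) : ℕ := if i = 0 then 0 else 1

/-- Left end of the interval coded by a letter. -/
noncomputable def lo (α β : ℝ) (i : Fin 3) : ℝ := if i = 0 then 0 else if i = 1 then α else α + β

/-- Right end of the interval coded by a letter. -/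
noncomputable def hi (α β : ℝ) (i : Fin 3) : ℝ := if i = 0 then α else if i = 1 then α + β else 1

/-- Total rotation time of the first `n` letters of a sequence. -/
def cumTime (v : ℕ → Fin 3) (n : ℕ) : ℕ := ∑ k ∈ Finset.range n, rotTime (v k)

/-- Total number of turns of the first `n` letters of a sequence. -/
def cumTurn (v : ℕ → Fin 3) (n : ℕ) : ℕ := ∑ k ∈ Finset.range n, turn (v k)

/-- The displacement of a point along the first `n` letters of its trajectory. -/
noncomputable def displacement (α β : ℝ) (v : ℕ → Fin 3) (n : ℕ) : ℝ :=
  cumTime v n * (1 - α) - cumTurn v n * (1 + β)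

lemma displacement_zero (α β : ℝ) (v : ℕ → Fin 3) : displacement α β v 0 = 0 := by
  simp [displacement, cumTime, cumTurn]

lemma displacement_succ (α β : ℝ) (v : ℕ → Fin 3) (n : ℕ) :
    displacement α β v (n + 1) =
      displacement α β v n + (rotTime (v n) * (1 - α) - turn (v n) * (1 + β)) := by
  simp only [displacement, cumTime, cumTurn, Finset.sum_range_succ]
  push_cast; ring

lemma displacement_congr {α β : ℝ} {v v' : ℕ → Fin 3} {n : ℕ} (h : ∀ k < n, v k = v' k) :
    displacement α β v n = displacement α β v' n := by
  have h1 : cumTime v n = cumTime v' n :=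
    Finset.sum_congr rfl fun k hk => by rw [h k (Finset.mem_range.1 hk)]
  have h2 : cumTurn v n = cumTurn v' n :=
    Finset.sum_congr rfl fun k hk => by rw [h k (Finset.mem_range.1 hk)]
  rw [displacement, displacement, h1, h2]

variable {α β : ℝ}

lemma Admissible.irrational (h : Admissible α β) : Irrational ((1 - α) / (1 + β)) := by
  rintro ⟨r, hr⟩
  have hc : (1 + β) ≠ 0 := by linarith [h.mid_pos]
  have hd : (r.den : ℝ) ≠ 0 := by exact_mod_cast r.den_ne_zero
  have h1 : (r : ℝ) = r.num / r.den := by exact_mod_cast (Rat.num_div_den r).symm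
  rw [h1, div_eq_div_iff hd hc] at hr
  refine (h.idoc r.den r.num ?_).1 ?_
  · simp
  · push_cast; linarith

lemma letter_eq_iff (h : Admissible α β) {x : ℝ} (hx : x ∈ Ico (0 : ℝ) 1) (i : Fin 3) :
    letter α β x = i ↔ x ∈ Ico (lo α β i) (hi α β i) := by
  have := h.left_pos
  have := h.mid_pos
  have := h.sum_lt
  obtain ⟨h0, h1⟩ := hx
  fin_cases i <;> simp only [letter, lo, hi, mem_Ico] <;> split_ifs <;> simp_all <;> linarith

/-- One step adds `1 - α` and removes a turn `1 + β` when needed; the middle interval first lands in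
`[1, 1 + β)` and takes a second rotation step to come back. -/
lemma exchange_eq (α β x : ℝ) :
    exchange α β x = x + (rotTime (letter α β x) * (1 - α) - turn (letter α β x) * (1 + β)) := by
  unfold exchange letter rotTime turn
  split_ifs <;> simp_all <;> ring

lemma exchange_mem (h : Admissible α β) {x : ℝ} (hx : x ∈ Ico (0 : ℝ) 1) :
    exchange α β x ∈ Ico (0 : ℝ) 1 := by
  have := h.left_pos
  have := h.mid_pos
  have := h.sum_lt
  obtain ⟨h0, h1⟩ := hx
  unfold exchange
  split_ifs <;> constructor <;> linarith

lemma iterate_mem (h : Admissible α β) {x : ℝ} (hx : x ∈ Ico (0 : ℝ) 1) (n : ℕ) :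
    (exchange α β)^[n] x ∈ Ico (0 : ℝ) 1 := by
  induction n with
  | zero => exact hx
  | succ n ih => rw [Function.iterate_succ_apply']; exact exchange_mem h ih

lemma iterate_eq (α β x : ℝ) (n : ℕ) :
    (exchange α β)^[n] x = x + displacement α β (trajectory α β x) n := by
  induction n with
  | zero => simp [displacement_zero]
  | succ n ih =>
    rw [Function.iterate_succ_apply', exchange_eq, displacement_succ, ← add_assoc, ← ih]
    rfl

/-- The trajectory of `z` starts with the first `n` letters of `v` exactly when the successive
displaced points are in the intervals of these letters. -/
lemma trajectory_agree_iff (h : Admissible α β) {z : ℝ} (hz : z ∈ Ico (0 : ℝ) 1)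
    (v : ℕ → Fin 3) (n : ℕ) :
    (∀ k < n, trajectory α β z k = v k) ↔
      ∀ k < n, z + displacement α β v k ∈ Ico (lo α β (v k)) (hi α β (v k)) := by
  induction n with
  | zero => simp
  | succ n ih =>
    simp only [Nat.forall_lt_succ_right]
    rw [← ih]
    refine and_congr_right fun hk => ?_
    rw [← letter_eq_iff h, ← displacement_congr hk, ← iterate_eq]
    · rfl
    · rw [← displacement_congr hk, ← iterate_eq]
      exact iterate_mem h hz n

/-- The points of `[0, 1)` whose trajectory starts with the first `n` letters of `v`. -/
def cell (α β : ℝ) (v : ℕ → Fin 3) (n : ℕ) : Set ℝ :=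
  {z | z ∈ Ico (0 : ℝ) 1 ∧ ∀ k < n, trajectory α β z k = v k}

lemma cell_zero (α β : ℝ) (v : ℕ → Fin 3) : cell α β v 0 = Ico 0 1 := by
  ext z; simp [cell]

lemma cell_eq (h : Admissible α β) (v : ℕ → Fin 3) {n : ℕ} (hn : 0 < n) :
    ∃ k < n, ∃ l < n, cell α β v n =
      Ico (lo α β (v k) - displacement α β v k) (hi α β (v l) - displacement α β v l) := by
  have hne : (Finset.range n).Nonempty := ⟨0, Finset.mem_range.2 hn⟩
  obtain ⟨k, hk, hk'⟩ := Finset.exists_max_image (Finset.range n)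
    (fun k => lo α β (v k) - displacement α β v k) hne
  obtain ⟨l, hl, hl'⟩ := Finset.exists_min_image (Finset.range n)
    (fun k => hi α β (v k) - displacement α β v k) hne
  refine ⟨k, Finset.mem_range.1 hk, l, Finset.mem_range.1 hl, ?_⟩
  ext z
  constructor
  · rintro ⟨hz, hz'⟩
    rw [trajectory_agree_iff h hz] at hz'
    have h1 := (hz' k (Finset.mem_range.1 hk)).1
    have h2 := (hz' l (Finset.mem_range.1 hl)).2
    constructor <;> linarith
  · rintro ⟨h1, h2⟩
    have h3 : ∀ m < n, z + displacement α β v m ∈ Ico (lo α β (v m)) (hi α β (v m)) := by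
      intro m hm
      have h4 := hk' m (Finset.mem_range.2 hm)
      have h5 := hl' m (Finset.mem_range.2 hm)
      constructor <;> linarith
    have h6 : z ∈ Ico (0 : ℝ) 1 := by
      have := h3 0 hn
      rw [displacement_zero, add_zero] at this
      have := h.left_pos
      have := h.mid_pos
      have := h.sum_lt
      have h7 : 0 ≤ lo α β (v 0) := by unfold lo; split_ifs <;> linarith
      have h8 : hi α β (v 0) ≤ 1 := by unfold hi; split_ifs <;> linarith
      exact ⟨h7.trans (h3 0 hn |>.1 |> (by simpa [displacement_zero] using ·)),
        (by simpa [displacement_zero] using (h3 0 hn).2 : z < hi α β (v 0)).trans_le h8⟩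
    exact ⟨h6, (trajectory_agree_iff h h6 v n).2 h3⟩

/-- A discontinuity of an iterate separates the points by their trajectories. -/
lemma not_agree_of_discontinuity (h : Admissible α β) {z₁ z₂ e : ℝ} (h₁ : z₁ ∈ Ico (0 : ℝ) 1)
    (h₂ : z₂ ∈ Ico (0 : ℝ) 1) (he₁ : z₁ < e) (he₂ : e ≤ z₂) {n k : ℕ} (hk : k < n)
    (he : (exchange α β)^[k] e = α ∨ (exchange α β)^[k] e = α + β) :
    ¬ ∀ j < n, trajectory α β z₁ j = trajectory α β z₂ j := by
  intro hagree
  have := h.left_pos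
  have := h.mid_pos
  have := h.sum_lt
  have h1 := (trajectory_agree_iff h h₁ _ n).1 hagree
  have h2 := (trajectory_agree_iff h h₂ (trajectory α β z₂) n).1 (fun _ _ => rfl)
  have he0 : e ∈ Ico (0 : ℝ) 1 := ⟨h₁.1.trans he₁.le, he₂.trans_lt h₂.2⟩
  have h3 : ∀ j < n, e + displacement α β (trajectory α β z₂) j ∈
      Ico (lo α β (trajectory α β z₂ j)) (hi α β (trajectory α β z₂ j)) := by
    intro j hj
    have := (h1 j hj).1
    have := (h2 j hj).2
    constructor <;> linarith
  have h4 := (trajectory_agree_iff h he0 _ n).2 h3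
  rw [iterate_eq, displacement_congr fun j hj => h4 j (hj.trans hk)] at he
  have h5 := (h1 k hk).1
  have h6 := (h3 k hk).2
  unfold lo at h5
  unfold hi at h6
  -- The displaced `e` is strictly to the right of the displaced `z₁`, so it is strictly inside the
  -- interval of its letter, which contains no discontinuity.
  rcases he with he | he <;> split_ifs at h5 h6 <;> linarith

/-! ### Uniform equidistribution of the exchange -/

lemma rotTime_bounds (i : Fin 3) : 1 ≤ rotTime i ∧ rotTime i ≤ 2 := by
  unfold rotTime; split_ifs <;> simp

lemma cumTime_bounds (v : ℕ → Fin 3) (n : ℕ) : n ≤ cumTime v n ∧ cumTime v n ≤ 2 * n := by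
  induction n with
  | zero => simp [cumTime]
  | succ n ih =>
    have := rotTime_bounds (v n)
    have h : cumTime v (n + 1) = cumTime v n + rotTime (v n) := Finset.sum_range_succ _ _
    omega

/-- The rotation, in the coordinate of the exchange. -/
noncomputable def rot (α β z : ℝ) (i : ℕ) : ℝ :=
  Int.fract (z / (1 + β) + i * ((1 - α) / (1 + β)))

lemma rot_eq (h : Admissible α β) {z x : ℝ} {i : ℕ} {l : ℤ} (hx : x ∈ Ico (0 : ℝ) (1 + β))
    (hz : x = z + i * (1 - α) - l * (1 + β)) : rot α β z i = x / (1 + β) := by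
  have hc : 0 < 1 + β := by linarith [h.mid_pos]
  rw [rot, Int.fract_eq_iff]
  refine ⟨div_nonneg hx.1 hc.le, (div_lt_one hc).2 hx.2, l, ?_⟩
  rw [hz]
  field_simp
  ring

lemma rot_cumTime (h : Admissible α β) {z : ℝ} (hz : z ∈ Ico (0 : ℝ) 1) (n : ℕ) :
    rot α β z (cumTime (trajectory α β z) n) = (exchange α β)^[n] z / (1 + β) := by
  have h1 := iterate_mem h hz n
  refine rot_eq h (l := cumTurn (trajectory α β z) n)
    ⟨h1.1, by linarith [h1.2, h.mid_pos]⟩ ?_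
  rw [iterate_eq, displacement]
  push_cast; ring

lemma rot_cumTime_succ (h : Admissible α β) {z : ℝ} (hz : z ∈ Ico (0 : ℝ) 1) {n : ℕ}
    (hn : trajectory α β z n = 1) :
    rot α β z (cumTime (trajectory α β z) n + 1) =
      ((exchange α β)^[n] z + (1 - α)) / (1 + β) ∧ α ≤ (exchange α β)^[n] z := by
  have h1 := iterate_mem h hz n
  have h2 := (letter_eq_iff h h1 1).1 hn
  simp only [lo, hi, one_ne_zero, if_false, if_true, mem_Ico] at h2
  refine ⟨rot_eq h (l := cumTurn (trajectory α β z) n)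
    ⟨by linarith [h1.1, h.sum_lt, h.mid_pos], by linarith [h1.2]⟩ ?_, h2.1⟩
  rw [iterate_eq, displacement]
  push_cast; ring

lemma hits_rot (h : Admissible α β) {z : ℝ} (hz : z ∈ Ico (0 : ℝ) 1) {a b : ℝ} (hb : b ≤ 1)
    (n : ℕ) :
    hits (rot α β z) (a / (1 + β)) (b / (1 + β)) (cumTime (trajectory α β z) n) =
      hits (fun k => (exchange α β)^[k] z) a b n := by
  have hc : 0 < 1 + β := by linarith [h.mid_pos]
  have hind : ∀ x : ℝ, (Ico (a / (1 + β)) (b / (1 + β))).indicator (fun _ => (1 : ℝ)) (x / (1 + β))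
      = (Ico a b).indicator (fun _ => (1 : ℝ)) x := by
    intro x
    simp only [indicator, mem_Ico, div_le_div_iff_of_pos_right hc, div_lt_div_iff_of_pos_right hc]
  induction n with
  | zero => simp [hits, cumTime]
  | succ n ih =>
    have h1 : cumTime (trajectory α β z) (n + 1) =
        cumTime (trajectory α β z) n + rotTime (trajectory α β z n) := Finset.sum_range_succ _ _
    rw [h1]
    unfold hits at ih ⊢
    rw [Finset.sum_range_succ _ n, ← ih]
    by_cases hn : trajectory α β z n = 1
    · obtain ⟨h2, h3⟩ := rot_cumTime_succ h hz hn
      have h4 : rotTime (trajectory α β z n) = 2 := by rw [hn]; rfl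
      rw [h4, Finset.sum_range_succ, Finset.sum_range_succ, rot_cumTime h hz, h2, hind, hind,
        indicator_of_notMem (a := (exchange α β)^[n] z + (1 - α)), add_zero]
      exact fun hh => by linarith [hh.2]
    · have h4 : rotTime (trajectory α β z n) = 1 := by simp [rotTime, hn]
      rw [h4, Finset.sum_range_succ, rot_cumTime h hz, hind]

/-- An orbit segment of length `n` is the part in `[0, 1)` of a rotation segment of length `N`. The
case of `[0, 1)` itself, where the count is `n`, shows that `N / (1 + β)` is close to `n`; the
general case is then compared with it. -/
theorem exchange_equidistribution (h : Admissible α β) {ε : ℝ} (hε : 0 < ε) :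
    ∃ n₀ : ℕ, ∀ n ≥ n₀, ∀ z ∈ Ico (0 : ℝ) 1, ∀ a b : ℝ, 0 ≤ a → a ≤ b → b ≤ 1 →
      |hits (fun k => (exchange α β)^[k] z) a b n - n * (b - a)| ≤ ε * n := by
  have hc : 0 < 1 + β := by linarith [h.mid_pos]
  obtain ⟨N₀, hN₀⟩ := rotation_equidistribution h.irrational (ε := ε / 4) (by positivity)
  refine ⟨N₀, fun n hn z hz a b ha hab hb => ?_⟩
  obtain ⟨hb1, hb2⟩ := cumTime_bounds (trajectory α β z) n
  set N := cumTime (trajectory α β z) n with hN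
  have hNr : (N : ℝ) ≤ 2 * n := by exact_mod_cast hb2
  have key : ∀ a b : ℝ, 0 ≤ a → a ≤ b → b ≤ 1 →
      |hits (fun k => (exchange α β)^[k] z) a b n - N / (1 + β) * (b - a)| ≤ ε / 2 * n := by
    intro a b ha hab hb
    have h1 := hN₀ N (hn.trans hb1) (z / (1 + β)) (a / (1 + β)) (b / (1 + β)) (by positivity)
      (by gcongr) (by rw [div_le_one hc]; linarith [h.mid_pos])
    have h2 := hits_rot h hz (a := a) hb n
    unfold rot at h2
    rw [← hN] at h2
    rw [h2] at h1
    have h3 : (N : ℝ) * (b / (1 + β) - a / (1 + β)) = N / (1 + β) * (b - a) := by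
      field_simp
    rw [h3] at h1
    refine h1.trans ?_
    nlinarith
  have h1 := key 0 1 le_rfl zero_le_one le_rfl
  have h2 : hits (fun k => (exchange α β)^[k] z) 0 1 n = n := by
    unfold hits
    rw [Finset.sum_congr rfl fun k _ => indicator_of_mem (iterate_mem h hz k) _]
    simp
  rw [h2] at h1
  have h3 := key a b ha hab hb
  rw [abs_le] at h1 h3 ⊢
  have h4 : 0 ≤ b - a := by linarith
  have h5 : b - a ≤ 1 := by linarith
  have h6 : (0 : ℝ) ≤ n := Nat.cast_nonneg n
  constructor <;> nlinarith

lemma cumTurn_eq (h : Admissible α β) {z : ℝ} (hz : z ∈ Ico (0 : ℝ) 1) (n : ℕ) :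
    (cumTurn (trajectory α β z) n : ℝ) = n - hits (fun k => (exchange α β)^[k] z) 0 α n := by
  induction n with
  | zero => simp [cumTurn, hits]
  | succ n ih =>
    have h1 : cumTurn (trajectory α β z) (n + 1) =
        cumTurn (trajectory α β z) n + turn (trajectory α β z n) := Finset.sum_range_succ _ _
    have h2 : (turn (trajectory α β z n) : ℝ) =
        1 - (Ico 0 α).indicator (fun _ => (1 : ℝ)) ((exchange α β)^[n] z) := by
      have h3 := letter_eq_iff h (iterate_mem h hz n) 0
      simp only [lo, hi, if_true] at h3
      change letter α β ((exchange α β)^[n] z) = 0 ↔ _ at h3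
      by_cases h4 : letter α β ((exchange α β)^[n] z) = 0
      · rw [indicator_of_mem (h3.1 h4)]
        simp [turn, trajectory, h4]
      · rw [indicator_of_notMem (fun hh => h4 (h3.2 hh))]
        simp [turn, trajectory, h4]
    rw [h1]
    push_cast
    rw [ih, h2]
    unfold hits
    rw [Finset.sum_range_succ]
    ring

theorem cumTurn_equidistribution (h : Admissible α β) {ε : ℝ} (hε : 0 < ε) :
    ∃ n₀ : ℕ, ∀ n ≥ n₀, ∀ z ∈ Ico (0 : ℝ) 1,
      |(cumTurn (trajectory α β z) n : ℝ) - n * (1 - α)| ≤ ε * n := by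
  obtain ⟨n₀, hn₀⟩ := exchange_equidistribution h hε
  refine ⟨n₀, fun n hn z hz => ?_⟩
  have h1 := hn₀ n hn z hz 0 α le_rfl h.left_pos.le (by linarith [h.sum_lt, h.mid_pos])
  rw [cumTurn_eq h hz, abs_sub_comm]
  convert h1 using 2
  ring

/-- A return of the rotation to `[0, 1)` is a step of the exchange. -/
lemma exists_iterate_eq (h : Admissible α β) {z e : ℝ} (hz : z ∈ Ico (0 : ℝ) 1)
    (he : e ∈ Ico (0 : ℝ) 1) {N : ℕ} {l : ℤ} (hN : e = z + N * (1 - α) - l * (1 + β)) :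
    ∃ n : ℕ, (exchange α β)^[n] z = e ∧ (cumTurn (trajectory α β z) n : ℤ) = l := by
  have hc : 0 < 1 + β := by linarith [h.mid_pos]
  have hrot := rot_eq h (z := z) (i := N) ⟨he.1, by linarith [he.2, h.mid_pos]⟩ hN
  obtain ⟨n, hn⟩ : ∃ n, cumTime (trajectory α β z) n = N := by
    -- The rotation times skipped by `cumTime` are the intermediate steps of the letter `1`, when
    -- the point is in `[1, 1 + β)`, hence not at `e`.
    by_contra! hne
    have hex : ∃ n, N < cumTime (trajectory α β z) n :=
      ⟨N + 1, Nat.lt_of_lt_of_le (Nat.lt_succ_self N) (cumTime_bounds _ _).1⟩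
    have h1 := Nat.find_spec hex
    rcases hm : Nat.find hex with _ | m
    · rw [hm] at h1
      simp [cumTime] at h1
    · rw [hm] at h1
      have h2 : ¬ N < cumTime (trajectory α β z) m := Nat.find_min hex (by omega)
      have h3 : cumTime (trajectory α β z) (m + 1) =
        cumTime (trajectory α β z) m + rotTime (trajectory α β z m) := Finset.sum_range_succ _ _
      have h4 := hne m
      have h5 := rotTime_bounds (trajectory α β z m)
      have h6 : trajectory α β z m = 1 := by
        by_contra h7
        have : rotTime (trajectory α β z m) = 1 := by simp [rotTime, h7]
        omega
      have h8 : N = cumTime (trajectory α β z) m + 1 := by omega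
      obtain ⟨h9, h10⟩ := rot_cumTime_succ h hz h6
      rw [← h8, hrot, div_left_inj' hc.ne'] at h9
      linarith [he.2]
  have h1 := rot_cumTime h hz n
  rw [hn, hrot, div_left_inj' hc.ne'] at h1
  refine ⟨n, h1.symm, ?_⟩
  have h2 := iterate_eq α β z n
  rw [displacement, hn, ← h1, hN] at h2
  have h3 : (l : ℝ) * (1 + β) = cumTurn (trajectory α β z) n * (1 + β) := by linarith
  have h4 := mul_right_cancel₀ hc.ne' h3
  exact_mod_cast h4.symm

/-! ### The invariant measure of the natural coding -/

section Words

variable {A : Type*}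

/-- The sequences which start with the first `n` letters of `v`. -/
def agreeSet (v : ℕ → A) (n : ℕ) : Set (ℕ → A) := {x | ∀ k < n, x k = v k}

lemma factor_eq_factor_iff (x y : ℕ → A) (r s n : ℕ) :
    factor x r n = factor y s n ↔ ∀ k < n, x (r + k) = y (s + k) := by
  rw [factor, factor, List.ofFn_inj, funext_iff]
  exact ⟨fun h k hk => h ⟨k, hk⟩, fun h k => h k k.2⟩

lemma length_factor (x : ℕ → A) (r n : ℕ) : (factor x r n).length = n := by simp [factor]

lemma agreeSet_congr {v w : ℕ → A} {n : ℕ} (h : w ∈ agreeSet v n) :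
    agreeSet v n = agreeSet w n := by
  ext x
  exact ⟨fun hx k hk => (hx k hk).trans (h k hk).symm, fun hx k hk => (hx k hk).trans (h k hk)⟩

lemma agreeSet_anti (v : ℕ → A) {m n : ℕ} (h : m ≤ n) : agreeSet v n ⊆ agreeSet v m :=
  fun _ hx k hk => hx k (hk.trans_le h)

lemma measurableSet_agreeSet [MeasurableSpace A] [MeasurableSingletonClass A] (v : ℕ → A) (n : ℕ) :
    MeasurableSet (agreeSet v n) := by
  have : agreeSet v n = ⋂ k, ⋂ _ : k < n, (fun x : ℕ → A => x k) ⁻¹' {v k} := by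
    ext x; simp [agreeSet]
  rw [this]
  exact MeasurableSet.iInter fun k => MeasurableSet.iInter fun _ =>
    measurable_pi_apply k (measurableSet_singleton _)

lemma measurableSet_symbolicSpace [MeasurableSpace A] [MeasurableSingletonClass A] [Finite A]
    (L : Language A) : MeasurableSet (symbolicSpace L) := by
  have : symbolicSpace L = ⋂ r : ℕ, ⋂ s : ℕ, ⋂ _ : r < s,
      (fun (x : ℕ → A) (i : Fin (s - r + 1)) => x (r + i)) ⁻¹' {g | List.ofFn g ∈ L} := by
    ext x
    simp [symbolicSpace, factor]
  rw [this]
  refine MeasurableSet.iInter fun r => MeasurableSet.iInter fun s => MeasurableSet.iInter fun _ => ?_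
  exact (measurable_pi_lambda _ fun i => measurable_pi_apply _) (Set.toFinite _).measurableSet

/-- Probability measures on sequences over a finite alphabet are determined by the sets of
sequences with given first letters. -/
lemma ext_of_agreeSet [Finite A] [MeasurableSpace A] [MeasurableSingletonClass A]
    {μ ν : Measure (ℕ → A)} [IsProbabilityMeasure μ] [IsProbabilityMeasure ν]
    (h : ∀ v n, μ (agreeSet v n) = ν (agreeSet v n)) : μ = ν := by
  refine ext_of_generate_finite {s | ∃ v n, s = agreeSet v n} ?_ ?_ ?_ (by simp)
  · refine le_antisymm ?_ (MeasurableSpace.generateFrom_le ?_)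
    · refine iSup_le fun k => ?_
      rw [← measurable_iff_comap_le]
      refine @measurable_to_countable' _ _ _ _ (_) _ fun i => ?_
      have : (fun x : ℕ → A => x k) ⁻¹' {i} =
          ⋃ g : {g : Fin (k + 1) → A // g (Fin.last k) = i},
            agreeSet (fun m => g.1 (Fin.ofNat (k + 1) m)) (k + 1) := by
        ext x
        simp only [mem_preimage, mem_singleton_iff, mem_iUnion]
        constructor
        · intro hx
          refine ⟨⟨fun m => x m, by simpa using hx⟩, fun m hm => ?_⟩
          simp [Nat.mod_eq_of_lt hm]
        · rintro ⟨⟨g, hg⟩, hx⟩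
          refine (hx k (Nat.lt_succ_self k)).trans (Eq.trans ?_ hg)
          change g (Fin.ofNat (k + 1) k) = g (Fin.last k)
          congr 1
          ext
          simp
      rw [this]
      exact MeasurableSet.iUnion fun g => MeasurableSpace.measurableSet_generateFrom ⟨_, _, rfl⟩
    · rintro _ ⟨v, n, rfl⟩
      exact measurableSet_agreeSet v n
  · rintro _ ⟨v, m, rfl⟩ _ ⟨w, n, rfl⟩ ⟨x, hx, hx'⟩
    rw [agreeSet_congr hx, agreeSet_congr hx']
    rcases le_total m n with hmn | hmn
    · exact ⟨x, n, inter_eq_right.2 (agreeSet_anti x hmn)⟩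
    · exact ⟨x, m, inter_eq_left.2 (agreeSet_anti x hmn)⟩
  · rintro _ ⟨v, n, rfl⟩
    exact h v n

end Words

lemma trajectory_iterate (α β x : ℝ) (r k : ℕ) :
    trajectory α β ((exchange α β)^[r] x) k = trajectory α β x (r + k) := by
  rw [trajectory, trajectory, add_comm r k, Function.iterate_add_apply]

lemma factor_trajectory (α β x : ℝ) (r n : ℕ) :
    factor (trajectory α β x) r n = factor (trajectory α β ((exchange α β)^[r] x)) 0 n := by
  rw [factor_eq_factor_iff]
  intro k _
  rw [trajectory_iterate, zero_add]

lemma mem_exchangeLanguage_iff (h : Admissible α β) {w : List (Fin 3)} :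
    w ∈ exchangeLanguage α β ↔
      ∃ z ∈ Ico (0 : ℝ) 1, w = factor (trajectory α β z) 0 w.length := by
  constructor
  · rintro ⟨x, hx, r, n, rfl⟩
    exact ⟨_, iterate_mem h hx r, by rw [length_factor, factor_trajectory]⟩
  · rintro ⟨z, hz, hw⟩
    exact ⟨z, hz, 0, _, hw⟩

lemma trajectory_mem_symbolicSpace {z : ℝ} (hz : z ∈ Ico (0 : ℝ) 1) :
    trajectory α β z ∈ symbolicSpace (exchangeLanguage α β) :=
  fun r _ _ => ⟨z, hz, r, _, rfl⟩

lemma cylinder_factor (L : Language (Fin 3)) (v : ℕ → Fin 3) (n : ℕ) :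
    cylinder L (factor v 0 n) = symbolicSpace L ∩ agreeSet v n := by
  ext x
  simp [cylinder, length_factor, factor_eq_factor_iff, agreeSet]

lemma exists_cell_eq (h : Admissible α β) (v : ℕ → Fin 3) (n : ℕ) :
    ∃ a b, 0 ≤ a ∧ a ≤ b ∧ b ≤ 1 ∧ cell α β v n = Ico a b := by
  rcases n.eq_zero_or_pos with rfl | hn
  · exact ⟨0, 1, le_rfl, zero_le_one, le_rfl, cell_zero α β v⟩
  obtain ⟨k, -, l, -, hkl⟩ := cell_eq h v hn
  rcases le_or_gt (hi α β (v l) - displacement α β v l)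
    (lo α β (v k) - displacement α β v k) with hle | hlt
  · exact ⟨0, 0, le_rfl, le_rfl, zero_le_one, by rw [hkl, Ico_eq_empty_of_le hle, Ico_self]⟩
  · have hsub : cell α β v n ⊆ Ico 0 1 := fun z hz => hz.1
    rw [hkl, Ico_subset_Ico_iff hlt] at hsub
    exact ⟨_, _, hsub.1, hlt.le, hsub.2, hkl⟩

lemma measurable_exchange : Measurable (exchange α β) := by
  unfold exchange
  exact Measurable.ite measurableSet_Iio (by fun_prop)
    (Measurable.ite measurableSet_Iio (by fun_prop) (by fun_prop))

lemma measurable_letter : Measurable (letter α β) := by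
  unfold letter
  exact Measurable.ite measurableSet_Iio measurable_const
    (Measurable.ite measurableSet_Iio measurable_const measurable_const)

lemma measurable_trajectory : Measurable (trajectory α β) :=
  measurable_pi_lambda _ fun n => measurable_letter.comp (measurable_exchange.iterate n)

lemma measurable_shift : Measurable (shift : (ℕ → Fin 3) → ℕ → Fin 3) :=
  measurable_pi_lambda _ fun n => measurable_pi_apply (n + 1)

lemma measurePreserving_exchange (h : Admissible α β) :
    MeasurePreserving (exchange α β) (volume.restrict (Ico 0 1)) (volume.restrict (Ico 0 1)) := by
  have := h.left_pos
  have := h.mid_pos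
  have := h.sum_lt
  refine ⟨measurable_exchange, Measure.ext fun S hS => ?_⟩
  rw [Measure.map_apply measurable_exchange hS, Measure.restrict_apply (measurable_exchange hS),
    Measure.restrict_apply hS]
  have key : ∀ t a b : ℝ, volume (Ico a b ∩ (fun x => x + t) ⁻¹' S) =
      volume (S ∩ Ico (a + t) (b + t)) := by
    intro t a b
    rw [← measure_preimage_add_right volume t (S ∩ Ico (a + t) (b + t))]
    congr 1
    ext x
    simp [and_comm]
  have h1 : exchange α β ⁻¹' S ∩ Ico 0 1 =
      (Ico 0 α ∩ (fun x => x + (1 - α)) ⁻¹' S) ∪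
      ((Ico α (α + β) ∩ (fun x => x + (1 - 2 * α - β)) ⁻¹' S) ∪
      (Ico (α + β) 1 ∩ (fun x => x + (-α - β)) ⁻¹' S)) := by
    ext x
    simp only [mem_inter_iff, mem_preimage, mem_union, mem_Ico, exchange]
    rcases lt_or_ge x α with hx | hx
    · rw [if_pos hx, show x + 1 - α = x + (1 - α) by ring]
      constructor
      · rintro ⟨h1, h2⟩
        exact Or.inl ⟨⟨h2.1, hx⟩, h1⟩
      · rintro (⟨h1, h2⟩ | ⟨h1, h2⟩ | ⟨h1, h2⟩)
        · exact ⟨h2, h1.1, by linarith⟩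
        · linarith [h1.1]
        · linarith [h1.1]
    · rw [if_neg hx.not_gt]
      rcases lt_or_ge x (α + β) with hx' | hx'
      · rw [if_pos hx', show x + 1 - 2 * α - β = x + (1 - 2 * α - β) by ring]
        constructor
        · rintro ⟨h1, h2⟩
          exact Or.inr (Or.inl ⟨⟨hx, hx'⟩, h1⟩)
        · rintro (⟨h1, h2⟩ | ⟨h1, h2⟩ | ⟨h1, h2⟩)
          · linarith [h1.2]
          · exact ⟨h2, by linarith, by linarith⟩
          · linarith [h1.1]
      · rw [if_neg hx'.not_gt, show x - α - β = x + (-α - β) by ring]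
        constructor
        · rintro ⟨h1, h2⟩
          exact Or.inr (Or.inr ⟨⟨hx', h2.2⟩, h1⟩)
        · rintro (⟨h1, h2⟩ | ⟨h1, h2⟩ | ⟨h1, h2⟩)
          · linarith [h1.2]
          · linarith [h1.2]
          · exact ⟨h2, by linarith, h1.2⟩
  have hm : ∀ t : ℝ, MeasurableSet ((fun x : ℝ => x + t) ⁻¹' S) :=
    fun t => (measurable_id.add_const t) hS
  rw [h1, measure_union _ ((measurableSet_Ico.inter (hm _)).union (measurableSet_Ico.inter (hm _))),
    measure_union _ (measurableSet_Ico.inter (hm _)), key, key, key]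
  · have h2 : S ∩ Ico 0 1 = (S ∩ Ico (0 + (1 - α)) (α + (1 - α))) ∪
        ((S ∩ Ico (α + (1 - 2 * α - β)) (α + β + (1 - 2 * α - β))) ∪
        (S ∩ Ico (α + β + (-α - β)) (1 + (-α - β)))) := by
      rw [← inter_union_distrib_left, ← inter_union_distrib_left]
      congr 1
      ext x
      simp only [mem_union, mem_Ico]
      constructor
      · rintro ⟨h2, h3⟩
        rcases lt_or_ge x (1 - α) with hx | hx
        · rcases lt_or_ge x (1 - α - β) with hx' | hx'
          · exact Or.inr (Or.inr ⟨by linarith, by linarith⟩)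
          · exact Or.inr (Or.inl ⟨by linarith, by linarith⟩)
        · exact Or.inl ⟨by linarith, by linarith⟩
      · rintro (⟨h2, h3⟩ | ⟨h2, h3⟩ | ⟨h2, h3⟩) <;> constructor <;> linarith
    rw [h2, measure_union _ ((hS.inter measurableSet_Ico).union (hS.inter measurableSet_Ico)),
      measure_union _ (hS.inter measurableSet_Ico)]
    · rw [Set.disjoint_left]
      rintro x ⟨-, hx⟩ ⟨-, hx'⟩
      linarith [hx.1, hx.2, hx'.1, hx'.2]
    · rw [Set.disjoint_left]
      rintro x ⟨-, hx⟩ (⟨-, hx'⟩ | ⟨-, hx'⟩) <;> linarith [hx.1, hx.2, hx'.1, hx'.2]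
  · rw [Set.disjoint_left]
    rintro x ⟨hx, -⟩ ⟨hx', -⟩
    linarith [hx.1, hx.2, hx'.1, hx'.2]
  · rw [Set.disjoint_left]
    rintro x ⟨hx, -⟩ (⟨hx', -⟩ | ⟨hx', -⟩) <;> linarith [hx.1, hx.2, hx'.1, hx'.2]

/-- The invariant measure of the natural coding. -/
noncomputable def codingMeasure (α β : ℝ) : Measure (ℕ → Fin 3) :=
  (volume.restrict (Ico 0 1)).map (trajectory α β)

instance : IsProbabilityMeasure (codingMeasure α β) := by
  constructor
  rw [codingMeasure, Measure.map_apply measurable_trajectory MeasurableSet.univ]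
  simp

lemma codingMeasure_agreeSet (v : ℕ → Fin 3) (n : ℕ) :
    codingMeasure α β (agreeSet v n) = volume (cell α β v n) := by
  have hm := measurableSet_agreeSet v n
  rw [codingMeasure, Measure.map_apply measurable_trajectory hm,
    Measure.restrict_apply (measurable_trajectory hm)]
  congr 1
  ext z
  simp [cell, agreeSet, and_comm]

lemma codingMeasure_symbolicSpace :
    ∀ᵐ x ∂(codingMeasure α β), x ∈ symbolicSpace (exchangeLanguage α β) := by
  refine (ae_map_iff measurable_trajectory.aemeasurable
    (p := fun x => x ∈ symbolicSpace (exchangeLanguage α β))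
    (measurableSet_symbolicSpace _)).2 ?_
  exact (ae_restrict_iff' measurableSet_Ico).2
    (ae_of_all _ fun z hz => trajectory_mem_symbolicSpace hz)

lemma codingMeasure_cylinder (v : ℕ → Fin 3) (n : ℕ) :
    codingMeasure α β (cylinder (exchangeLanguage α β) (factor v 0 n)) =
      volume (cell α β v n) := by
  rw [cylinder_factor, ← codingMeasure_agreeSet]
  refine measure_congr ?_
  filter_upwards [codingMeasure_symbolicSpace (α := α) (β := β)] with x hx
  exact propext ⟨fun h => h.2, fun h => ⟨hx, h⟩⟩

lemma isInvariantProbability_codingMeasure (h : Admissible α β) :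
    IsInvariantProbability (exchangeLanguage α β) (codingMeasure α β) where
  isProbabilityMeasure := inferInstance
  carried := codingMeasure_symbolicSpace
  invariant := by
    refine ⟨measurable_shift, ?_⟩
    have h1 : (shift ∘ trajectory α β) = trajectory α β ∘ exchange α β := by
      funext z n
      simp [shift, trajectory]
    rw [codingMeasure, Measure.map_map measurable_shift measurable_trajectory, h1,
      ← Measure.map_map measurable_trajectory measurable_exchange,
      (measurePreserving_exchange h).map_eq]

lemma iterate_shift (x : ℕ → Fin 3) (k m : ℕ) : shift^[k] x m = x (k + m) := by
  induction k generalizing m with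
  | zero => simp
  | succ k ih =>
    rw [Function.iterate_succ_apply']
    change shift^[k] x (m + 1) = _
    rw [ih]; congr 1; omega

/-- The visits of a point of the symbolic space to a set of sequences with given first letters
are the visits of an orbit of the exchange to a cell. -/
lemma exists_sum_indicator_eq_hits (h : Admissible α β) {x : ℕ → Fin 3}
    (hx : x ∈ symbolicSpace (exchangeLanguage α β)) (v : ℕ → Fin 3) (m n : ℕ) {a b : ℝ}
    (hab : cell α β v m = Ico a b) :
    ∃ z ∈ Ico (0 : ℝ) 1, ∑ k ∈ Finset.range n,
      (agreeSet v m).indicator (fun _ => (1 : ℝ)) (shift^[k] x) =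
        hits (fun k => (exchange α β)^[k] z) a b n := by
  -- A point of the symbolic space need not be a trajectory, but its prefixes are prefixes of
  -- trajectories; the length `m + n + 2` covers all the visits counted.
  obtain ⟨z, hz, hw⟩ := (mem_exchangeLanguage_iff h).1 (hx 0 (m + n + 1) (by omega))
  rw [length_factor, factor_eq_factor_iff] at hw
  refine ⟨z, hz, Finset.sum_congr rfl fun k hk => ?_⟩
  rw [Finset.mem_range] at hk
  have : shift^[k] x ∈ agreeSet v m ↔ (exchange α β)^[k] z ∈ Ico a b := by
    rw [← hab]
    simp only [agreeSet, cell, mem_ofPred_eq, iterate_mem h hz k, true_and]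
    refine forall₂_congr fun i hi => ?_
    have h1 := hw (k + i) (by omega)
    simp only [zero_add] at h1
    rw [iterate_shift, trajectory_iterate, h1]
  by_cases h1 : shift^[k] x ∈ agreeSet v m
  · rw [indicator_of_mem h1, indicator_of_mem (this.1 h1)]
  · rw [indicator_of_notMem h1, indicator_of_notMem (fun hh => h1 (this.2 hh))]

/-- Birkhoff sums of the indicator of a cell are uniformly close to `n` times its length.
Integrating them against any invariant `ν` forces the `ν`-measure to be this length. -/
theorem isUniqueInvariantProbability_codingMeasure (h : Admissible α β) :
    IsUniqueInvariantProbability (exchangeLanguage α β) (codingMeasure α β) := by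
  refine ⟨isInvariantProbability_codingMeasure h, fun ν hν => ?_⟩
  have := hν.isProbabilityMeasure
  refine ext_of_agreeSet fun v m => ?_
  obtain ⟨a, b, ha, hab, hb, hcell⟩ := exists_cell_eq h v m
  rw [codingMeasure_agreeSet, hcell, Real.volume_Ico]
  set B := agreeSet v m
  have hB : MeasurableSet B := measurableSet_agreeSet v m
  have hreal : ν.real B = b - a := by
    refine eq_of_forall_dist_le fun ε hε => ?_
    obtain ⟨n₀, hn₀⟩ := exchange_equidistribution h hε
    set n := n₀ + 1
    have hn : (0 : ℝ) < n := by positivity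
    have hmp : ∀ k, MeasurePreserving (shift^[k]) ν ν := fun k => hν.invariant.iterate k
    have hint : ∀ k, Integrable (fun x => B.indicator (fun _ => (1 : ℝ)) (shift^[k] x)) ν :=
      fun k => (hmp k).integrable_comp_of_integrable
        ((integrable_const (1 : ℝ)).indicator hB)
    have h1 : ∀ k, ∫ x, B.indicator (fun _ => (1 : ℝ)) (shift^[k] x) ∂ν = ν.real B := by
      intro k
      have : (fun x => B.indicator (fun _ => (1 : ℝ)) (shift^[k] x)) =
          (shift^[k] ⁻¹' B).indicator (fun _ => (1 : ℝ)) := rfl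
      rw [this, integral_indicator_const _ ((hmp k).measurable hB), smul_eq_mul, mul_one,
        measureReal_def, (hmp k).measure_preimage hB.nullMeasurableSet, measureReal_def]
    have h2 : ∫ x, (∑ k ∈ Finset.range n, B.indicator (fun _ => (1 : ℝ)) (shift^[k] x)
        - n * (b - a)) ∂ν = n * ν.real B - n * (b - a) := by
      rw [integral_sub (integrable_finsetSum _ fun k _ => hint k) (integrable_const _),
        integral_finsetSum _ fun k _ => hint k, Finset.sum_congr rfl fun k _ => h1 k]
      simp
    have h3 : ‖∫ x, (∑ k ∈ Finset.range n, B.indicator (fun _ => (1 : ℝ)) (shift^[k] x)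
        - n * (b - a)) ∂ν‖ ≤ ε * n * ν.real univ := by
      refine norm_integral_le_of_norm_le_const ?_
      filter_upwards [hν.carried] with x hx
      obtain ⟨z, hz, hzx⟩ := exists_sum_indicator_eq_hits h hx v m n hcell
      rw [hzx]
      exact hn₀ n (Nat.le_succ _) z hz a b ha hab hb
    rw [h2, probReal_univ, mul_one, ← mul_sub, norm_mul, Real.norm_of_nonneg hn.le,
      mul_comm ε] at h3
    exact le_of_mul_le_mul_left h3 hn
  rw [← hreal, ofReal_measureReal]

/-! ### The upper bound and the lower bound for `limsup 1 / (n e_n)` -/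

lemma cumTurn_mono (v : ℕ → Fin 3) : Monotone (cumTurn v) :=
  fun _ _ h => Finset.sum_le_sum_of_subset (Finset.range_mono h)

lemma cumTurn_le (v : ℕ → Fin 3) (n : ℕ) : cumTurn v n ≤ n := by
  refine (Finset.sum_le_card_nsmul _ _ 1 fun k _ => ?_).trans (by simp)
  unfold turn; split_ifs <;> simp

/-- The length of a cell in the module generated by the three lengths of the exchange. -/
lemma cell_length (h : Admissible α β) {v : ℕ → Fin 3} {n : ℕ} (hn : 0 < n) {a b : ℝ} (hab : a < b)
    (hcell : cell α β v n = Ico a b) :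
    ∃ N l τ : ℤ, (τ = -1 ∨ τ = 0 ∨ τ = 1) ∧ |l| ≤ cumTurn v n + 1 ∧
      b - a = N * (1 - α) - l * (1 + β) + τ * β := by
  obtain ⟨k, hk, l, hl, hkl⟩ := cell_eq h v hn
  rw [hcell] at hkl
  have hne : (Ico a b).Nonempty := nonempty_Ico.2 hab
  have hlt : lo α β (v k) - displacement α β v k < hi α β (v l) - displacement α β v l := by
    rw [hkl] at hne; exact nonempty_Ico.1 hne
  obtain ⟨h1, h2⟩ := (Ico_eq_Ico_iff (Or.inl hab)).1 hkl
  have h3 := cumTurn_mono v hk.le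
  have h4 := cumTurn_mono v hl.le
  -- The ends `0, α, α + β, 1` are written in the generators `1 - α`, `1 + β`, `β`. All right ends
  -- get coefficient `1` on `1 + β`, and each `τ` is `-1` or `0`, so the difference of the two `τ`
  -- stays in `{-1, 0, 1}`.
  have hlo : ∃ m r τ : ℤ, (τ = -1 ∨ τ = 0) ∧ (r = 0 ∨ r = 1) ∧ (τ = -1 → r = 1) ∧
      lo α β (v k) = m * (1 - α) + r * (1 + β) + τ * β := by
    unfold lo
    split_ifs
    · exact ⟨0, 0, 0, by simp⟩
    · exact ⟨-1, 1, -1, by simp, by simp, by simp, by push_cast; ring⟩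
    · exact ⟨-1, 1, 0, by simp, by simp, by simp, by push_cast; ring⟩
  have hhi : ∃ m τ : ℤ, (τ = -1 ∨ τ = 0) ∧
      hi α β (v l) = m * (1 - α) + (1 + β) + τ * β := by
    unfold hi
    split_ifs
    · exact ⟨-1, -1, by simp, by push_cast; ring⟩
    · exact ⟨-1, 0, by simp, by push_cast; ring⟩
    · exact ⟨0, -1, by simp, by push_cast; ring⟩
  obtain ⟨m, r, τ, hτ, hr, hτr, h5⟩ := hlo
  obtain ⟨m', τ', hτ', h6⟩ := hhi
  refine ⟨m' - m - cumTime v l + cumTime v k, r - 1 - cumTurn v l + cumTurn v k, τ' - τ, ?_, ?_, ?_⟩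
  · omega
  · rw [abs_le]; omega
  · rw [h1, h2, h5, h6, displacement, displacement]
    push_cast
    ring

/-- For each of the finitely many `(l, τ)`, the positive values form an arithmetic progression with
a least element. Cells with small `|l|` are thus too long to matter for large `n`. -/
lemma exists_lower_bound_of_bounded (h : Admissible α β) (K : ℕ) :
    ∃ δ > 0, ∀ N l τ : ℤ, (τ = -1 ∨ τ = 0 ∨ τ = 1) → |l| ≤ K →
      0 < N * (1 - α) - l * (1 + β) + τ * β → δ ≤ N * (1 - α) - l * (1 + β) + τ * β := by
  have hw : 0 < 1 - α := by linarith [h.sum_lt, h.mid_pos]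
  set u : ℤ → ℤ → ℝ := fun l τ => l * (1 + β) - τ * β
  set d : ℤ → ℤ → ℝ := fun l τ => (⌊u l τ / (1 - α)⌋ + 1) * (1 - α) - u l τ
  have hd : ∀ l τ, 0 < d l τ := by
    intro l τ
    have := Int.lt_floor_add_one (u l τ / (1 - α))
    rw [div_lt_iff₀ hw] at this
    simp only [d]; linarith
  have h1 : ∀ᶠ δ in nhdsWithin (0 : ℝ) (Ioi 0), ∀ l ∈ Finset.Icc (-(K : ℤ)) K,
      ∀ τ ∈ Finset.Icc (-1 : ℤ) 1, δ ≤ d l τ := by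
    rw [Finset.eventually_all]
    intro l _
    rw [Finset.eventually_all]
    intro τ _
    exact nhdsWithin_le_nhds (Iic_mem_nhds (hd l τ))
  obtain ⟨δ, hδ, hδ0⟩ := (h1.and self_mem_nhdsWithin).exists
  refine ⟨δ, hδ0, fun N l τ hτ hl hpos => ?_⟩
  have h2 := hδ l (Finset.mem_Icc.2 (abs_le.1 hl)) τ (Finset.mem_Icc.2 (by omega))
  refine h2.trans ?_
  have h3 : u l τ / (1 - α) < N := by
    rw [div_lt_iff₀ hw]; simp only [u]; linarith
  have h4 : ⌊u l τ / (1 - α)⌋ + 1 ≤ N := Int.add_one_le_iff.2 (Int.floor_lt.2 h3)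
  have h5 : ((⌊u l τ / (1 - α)⌋ : ℝ) + 1) ≤ N := by exact_mod_cast h4
  have h6 := mul_le_mul_of_nonneg_right h5 hw.le
  simp only [d, u] at h6 ⊢
  linarith

/-- A Diophantine lower bound gives an upper bound for `limsup 1 / (n e_n)`. -/
theorem upperB_le (h : Admissible α β) {B : ℝ} (hB : 0 < B) (K : ℕ)
    (hU : ∀ l : ℤ, K ≤ |l| → ∀ N : ℤ, 1 - α ≤ B * |(l : ℝ)| * |N * (1 - α) - l * (1 + β)| ∧
      1 - α ≤ B * |(l : ℝ)| * |N * (1 - α) - l * (1 + β) - β|) :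
    upperB (exchangeLanguage α β) (codingMeasure α β) ≤ ENNReal.ofReal B := by
  have hw : 0 < 1 - α := by linarith [h.sum_lt, h.mid_pos]
  set w := 1 - α with hwdef
  have main : ∀ η > 0, upperB (exchangeLanguage α β) (codingMeasure α β) ≤
      ENNReal.ofReal (B * (1 + η)) := by
    intro η hη
    obtain ⟨δ, hδ, hδ'⟩ := exists_lower_bound_of_bounded h K
    obtain ⟨n₀, hn₀⟩ := cumTurn_equidistribution h (ε := η * w / 2) (by positivity)
    obtain ⟨n₁, hn₁⟩ := exists_nat_ge (2 / (η * w))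
    obtain ⟨n₂, hn₂⟩ := exists_nat_ge (1 / (B * (1 + η) * δ))
    refine limsup_le_of_le (h := ?_)
    filter_upwards [eventually_ge_atTop (n₀ + n₁ + n₂ + 1)] with n hn
    have hn0 : (0 : ℝ) < n := by exact_mod_cast (by omega : 0 < n)
    have hn1 : (n₁ : ℝ) ≤ n := by exact_mod_cast (by omega : n₁ ≤ n)
    have hn2 : (n₂ : ℝ) ≤ n := by exact_mod_cast (by omega : n₂ ≤ n)
    have hmin : ENNReal.ofReal (1 / (B * (1 + η) * n)) ≤
        minFrequency (exchangeLanguage α β) (codingMeasure α β) n := by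
      refine le_sInf ?_
      rintro f ⟨hf, u, hu, hun, rfl⟩
      obtain ⟨z, hz, hzu⟩ := (mem_exchangeLanguage_iff h).1 hu
      rw [hun] at hzu
      obtain ⟨a, b, -, hab, -, hcell⟩ := exists_cell_eq h (trajectory α β z) n
      have hmem : z ∈ cell α β (trajectory α β z) n := ⟨hz, fun _ _ => rfl⟩
      have hlt : a < b := by rw [hcell] at hmem; exact hmem.1.trans_lt hmem.2
      rw [hzu, codingMeasure_cylinder, hcell, Real.volume_Ico]
      refine ENNReal.ofReal_le_ofReal ?_
      obtain ⟨N, l, τ, hτ, hl, hlen⟩ := cell_length h (by omega) hlt hcell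
      have hpos : 0 < b - a := by linarith
      rw [div_le_iff₀ (by positivity)]
      rcases le_or_gt (K : ℤ) |l| with hK | hK
      · have h1 : w ≤ B * |(l : ℝ)| * (b - a) := by
          rcases hτ with rfl | rfl | rfl
          · have := (hU l hK N).2
            rw [← abs_of_pos hpos, hlen]
            convert this using 3
            push_cast; ring
          · have := (hU l hK N).1
            rw [← abs_of_pos hpos, hlen]
            convert this using 3
            push_cast; ring
          -- The case `τ = 1` is the case `τ = -1` after changing the sign of the whole form.
          · have := (hU (-l) (by rwa [abs_neg]) (-N)).2
            rw [← abs_of_pos hpos, hlen]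
            push_cast at this ⊢
            rw [abs_neg, ← abs_neg (_ - _ - _)] at this
            convert this using 3
            ring
        have h2 : |(l : ℝ)| ≤ cumTurn (trajectory α β z) n + 1 := by exact_mod_cast hl
        have h3 := (abs_le.1 (hn₀ n (by omega) z hz)).2
        have h4 : 1 ≤ η * w / 2 * n := by
          have := hn₁.trans hn1
          rw [div_le_iff₀ (by positivity)] at this
          linarith
        have h5 : |(l : ℝ)| ≤ (1 + η) * n * w := by nlinarith
        have h6 : w * 1 ≤ w * ((b - a) * (B * (1 + η) * n)) := by
          calc w * 1 ≤ B * |(l : ℝ)| * (b - a) := by linarith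
            _ ≤ B * ((1 + η) * n * w) * (b - a) := by gcongr
            _ = _ := by ring
        exact le_of_mul_le_mul_left h6 hw
      · have h1 := hδ' N l τ hτ hK.le (by rw [← hlen]; exact hpos)
        rw [← hlen] at h1
        have h2 := hn₂.trans hn2
        rw [div_le_iff₀ (by positivity)] at h2
        have : 0 < B * (1 + η) * n := by positivity
        nlinarith
    have h1 : (n : ℝ≥0∞) * ENNReal.ofReal (1 / (B * (1 + η) * n)) =
        ENNReal.ofReal (1 / (B * (1 + η))) := by
      rw [← ENNReal.ofReal_natCast, ← ENNReal.ofReal_mul hn0.le]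
      congr 1; field_simp
    calc 1 / ((n : ℝ≥0∞) * minFrequency (exchangeLanguage α β) (codingMeasure α β) n)
        ≤ 1 / ((n : ℝ≥0∞) * ENNReal.ofReal (1 / (B * (1 + η) * n))) := by gcongr
      _ = ENNReal.ofReal (B * (1 + η)) := by
        rw [h1, one_div, one_div, ENNReal.ofReal_inv_of_pos (by positivity), inv_inv]
  have hlim : Tendsto (fun η : ℝ => ENNReal.ofReal (B * (1 + η))) (nhdsWithin 0 (Ioi 0))
      (nhds (ENNReal.ofReal B)) := by
    refine ENNReal.tendsto_ofReal ?_
    have : Tendsto (fun η : ℝ => B * (1 + η)) (nhds 0) (nhds (B * (1 + 0))) :=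
      Continuous.tendsto (by fun_prop) 0
    rw [add_zero, mul_one] at this
    exact this.mono_left nhdsWithin_le_nhds
  exact ge_of_tendsto hlim (by filter_upwards [self_mem_nhdsWithin] with η hη using main η hη)

/-- Near-coincidences of discontinuities of iterates of the exchange give small cells. -/
lemma minFrequency_le_of_connection (h : Admissible α β) {p q d : ℝ} (hp : p = α ∨ p = α + β)
    (hq : q = α ∨ q = α + β) (hd : d ∈ Ico (0 : ℝ) 1) {N : ℕ} {l : ℤ} (hne : d ≠ q)
    (hN : p = d + N * (1 - α) - l * (1 + β)) :
    ∃ n : ℕ, (cumTurn (trajectory α β d) n : ℤ) = l ∧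
      minFrequency (exchangeLanguage α β) (codingMeasure α β) (n + 1) ≤
        ENNReal.ofReal |d - q| := by
  have := h.left_pos
  have := h.mid_pos
  have := h.sum_lt
  have hp' : p ∈ Ico (0 : ℝ) 1 := by rcases hp with rfl | rfl <;> constructor <;> linarith
  have hq' : q ∈ Ico (0 : ℝ) 1 := by rcases hq with rfl | rfl <;> constructor <;> linarith
  obtain ⟨n, hn, hl⟩ := exists_iterate_eq h hd hp' hN
  refine ⟨n, hl, ?_⟩
  have hd' : (exchange α β)^[n] d = α ∨ (exchange α β)^[n] d = α + β := by rw [hn]; exact hp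
  have hq'' : (exchange α β)^[0] q = α ∨ (exchange α β)^[0] q = α + β := hq
  have key : ∃ x y : ℝ, x ∈ Ico (0 : ℝ) 1 ∧ x < y ∧ y - x = |d - q| ∧
      (∃ k < n + 1, (exchange α β)^[k] x = α ∨ (exchange α β)^[k] x = α + β) ∧
      (∃ k < n + 1, (exchange α β)^[k] y = α ∨ (exchange α β)^[k] y = α + β) := by
    rcases lt_or_gt_of_ne hne with hlt | hlt
    · exact ⟨d, q, hd, hlt, by rw [abs_of_neg (by linarith)]; ring, ⟨n, by omega, hd'⟩,
        ⟨0, by omega, hq''⟩⟩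
    · exact ⟨q, d, hq', hlt, by rw [abs_of_pos (by linarith)], ⟨0, by omega, hq''⟩,
        ⟨n, by omega, hd'⟩⟩
  obtain ⟨x, y, hx, hxy, hdist, ⟨k, hk, hk'⟩, ⟨m, hm, hm'⟩⟩ := key
  obtain ⟨a, b, -, -, -, hcell⟩ := exists_cell_eq h (trajectory α β x) (n + 1)
  have hmem : x ∈ cell α β (trajectory α β x) (n + 1) := ⟨hx, fun _ _ => rfl⟩
  have hsub : cell α β (trajectory α β x) (n + 1) ⊆ Ico x y := by
    rintro z ⟨hz, hz'⟩
    refine ⟨?_, ?_⟩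
    · by_contra! hlt
      exact not_agree_of_discontinuity h hz hx hlt le_rfl hk hk' hz'
    · by_contra! hle
      exact not_agree_of_discontinuity h hx hz hxy hle hm hm' fun j hj => (hz' j hj).symm
  rw [hcell] at hmem hsub
  have hab : a < b := hmem.1.trans_lt hmem.2
  rw [Ico_subset_Ico_iff hab] at hsub
  calc minFrequency (exchangeLanguage α β) (codingMeasure α β) (n + 1)
      ≤ ENNReal.ofReal (b - a) := by
        refine sInf_le ⟨ENNReal.ofReal_pos.2 (by linarith), factor (trajectory α β x) 0 (n + 1),
          ⟨x, hx, 0, _, rfl⟩, length_factor _ _ _, ?_⟩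
        rw [codingMeasure_cylinder, hcell, Real.volume_Ico]
    _ ≤ ENNReal.ofReal |d - q| := ENNReal.ofReal_le_ofReal (by linarith [hsub.1, hsub.2])

/-- Good Diophantine approximations give a lower bound for `limsup 1 / (n e_n)`. -/
theorem le_upperB (h : Admissible α β) {B : ℝ} (hB : 0 < B)
    (hL : ∀ K : ℕ, ∃ l : ℤ, K ≤ |l| ∧ ∃ N : ℤ,
      B * |(l : ℝ)| * |N * (1 - α) - l * (1 + β) - β| ≤ 1 - α) :
    ENNReal.ofReal B ≤ upperB (exchangeLanguage α β) (codingMeasure α β) := by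
  have hα := h.left_pos
  have hβ := h.mid_pos
  have hαβ := h.sum_lt
  have hw : 0 < 1 - α := by linarith
  set w := 1 - α with hwdef
  have main : ∀ η : ℝ, 0 < η → ENNReal.ofReal (B / (1 + η)) ≤
      upperB (exchangeLanguage α β) (codingMeasure α β) := by
    intro η hη
    obtain ⟨n₀, hn₀⟩ := cumTurn_equidistribution h (ε := η * w / (2 + 2 * η)) (by positivity)
    refine le_limsup_of_frequently_le ?_
    rw [frequently_atTop]
    intro K₀
    -- A form of size at most `s` keeps the shifted discontinuity `d` in `[0, 1)` and forces `N` to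
    -- have the sign of `l`, so that the orbit goes forward in time.
    obtain ⟨s, hs0, hs⟩ : ∃ s > 0, s ≤ α ∧ s < 1 - α - β :=
      ⟨min α ((1 - α - β) / 2), lt_min hα (by linarith), min_le_left _ _,
        (min_le_right _ _).trans_lt (by linarith)⟩
    obtain ⟨n₁, hn₁⟩ := exists_nat_ge (w / (B * s))
    obtain ⟨n₂, hn₂⟩ := exists_nat_ge (2 / η)
    obtain ⟨l, hl, N, hlN⟩ := hL (K₀ + n₀ + n₁ + n₂ + 3)
    set v := N * w - l * (1 + β) - β with hv
    have hlr : ((K₀ + n₀ + n₁ + n₂ + 3 : ℕ) : ℝ) ≤ |(l : ℝ)| := by exact_mod_cast hl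
    push_cast at hlr
    have hl0 : 0 < |(l : ℝ)| := by linarith [(by positivity : (0 : ℝ) ≤ K₀ + n₀ + n₁ + n₂)]
    have hvs : |v| ≤ s := by
      have h1 : w / (B * s) ≤ |(l : ℝ)| := by
        have : (0 : ℝ) ≤ K₀ + n₀ + n₂ := by positivity
        linarith
      rw [div_le_iff₀ (by positivity)] at h1
      have h2 : B * |(l : ℝ)| * |v| ≤ B * |(l : ℝ)| * s := by linarith
      exact le_of_mul_le_mul_left h2 (by positivity)
    have hv0 : v ≠ 0 := by
      intro h0
      refine (h.idoc N (l + 1) ?_).2.1 ?_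
      · intro h1
        simp only [Prod.mk.injEq] at h1
        rw [abs_eq_neg_self.2 (by omega)] at hl
        omega
      · rw [hv, hwdef] at h0
        push_cast
        linarith
    have key : ∃ p q d : ℝ, (p = α ∨ p = α + β) ∧ (q = α ∨ q = α + β) ∧ d ∈ Ico (0 : ℝ) 1 ∧
        |d - q| = |v| ∧ ∃ (M : ℕ) (m : ℤ), |l| = m ∧ p = d + M * w - m * (1 + β) := by
      rw [abs_le] at hvs
      rcases le_or_gt 0 l with h0 | h0
      · have hN : 0 ≤ N := by
          by_contra! hN
          have h1 : (N : ℝ) ≤ -1 := by exact_mod_cast (by omega : N ≤ -1)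
          have h2 : (0 : ℝ) ≤ l := by exact_mod_cast h0
          nlinarith
        -- The orbit of `α - v` hits the discontinuity `α + β`. For negative `l` the roles of the
        -- two discontinuities are exchanged.
        refine ⟨α + β, α, α - v, Or.inr rfl, Or.inl rfl, ⟨by linarith, by linarith⟩, ?_,
          N.toNat, l, abs_of_nonneg h0, ?_⟩
        · rw [← abs_neg]; congr 1; ring
        · have : ((N.toNat : ℕ) : ℝ) = N := by exact_mod_cast Int.toNat_of_nonneg hN
          rw [this, hv]; ring
      · have hN : N ≤ 0 := by
          by_contra! hN
          have h1 : (1 : ℝ) ≤ N := by exact_mod_cast hN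
          have h2 : (l : ℝ) ≤ -1 := by exact_mod_cast (by omega : l ≤ -1)
          nlinarith
        refine ⟨α, α + β, α + β + v, Or.inl rfl, Or.inr rfl, ⟨by linarith, by linarith⟩, ?_,
          (-N).toNat, -l, abs_of_neg h0, ?_⟩
        · congr 1; ring
        · have : (((-N).toNat : ℕ) : ℝ) = -N := by
            exact_mod_cast Int.toNat_of_nonneg (by omega : 0 ≤ -N)
          rw [this, hv]; push_cast; ring
    obtain ⟨p, q, d, hp, hq, hd, hdq, M, m, hm, hpd⟩ := key
    have hne : d ≠ q := by
      rintro rfl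
      rw [sub_self, abs_zero, eq_comm, abs_eq_zero] at hdq
      exact hv0 hdq
    obtain ⟨n, hn, hmin⟩ := minFrequency_le_of_connection h hp hq hd hne hpd
    have hmn : |l| ≤ n := by
      rw [hm, ← hn]; exact_mod_cast cumTurn_le _ _
    refine ⟨n + 1, by omega, ?_⟩
    have hlt : (cumTurn (trajectory α β d) n : ℝ) = |(l : ℝ)| := by
      rw [← hm] at hn; exact_mod_cast hn
    have h1 := (abs_le.1 (hn₀ n (by omega) d hd)).1
    rw [hlt] at h1
    have hmnr : |(l : ℝ)| ≤ n := by exact_mod_cast hmn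
    have h2 : (n + 1 : ℝ) * w ≤ (1 + η) * |(l : ℝ)| := by
      have h3 : 2 / η ≤ n := by
        have : (0 : ℝ) ≤ K₀ + n₀ + n₁ := by positivity
        linarith
      rw [div_le_iff₀ hη] at h3
      have h4 : η * w / (2 + 2 * η) * n * (2 + 2 * η) = η * w * n := by field_simp
      rw [← hwdef] at h1
      have h5 := mul_le_mul_of_nonneg_left h1 (by linarith : 0 ≤ 1 + η)
      have h6 := mul_le_mul_of_nonneg_left h3 hw.le
      linarith
    have h3 : (n + 1 : ℝ) * |v| ≤ (1 + η) / B := by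
      rw [le_div_iff₀ hB]
      have : w * ((n + 1 : ℝ) * |v| * B) ≤ w * (1 + η) := by
        calc w * ((n + 1 : ℝ) * |v| * B) = ((n + 1 : ℝ) * w) * (|v| * B) := by ring
          _ ≤ ((1 + η) * |(l : ℝ)|) * (|v| * B) := by gcongr
          _ = (1 + η) * (B * |(l : ℝ)| * |v|) := by ring
          _ ≤ (1 + η) * w := by gcongr
          _ = w * (1 + η) := mul_comm _ _
      exact le_of_mul_le_mul_left this hw
    have h4 : ((n + 1 : ℕ) : ℝ≥0∞) * minFrequency (exchangeLanguage α β) (codingMeasure α β) (n + 1)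
        ≤ ENNReal.ofReal ((1 + η) / B) := by
      calc _ ≤ ((n + 1 : ℕ) : ℝ≥0∞) * ENNReal.ofReal |v| := by
            rw [← hdq]; gcongr
        _ = ENNReal.ofReal ((n + 1 : ℕ) * |v|) := by
            rw [← ENNReal.ofReal_natCast, ← ENNReal.ofReal_mul (Nat.cast_nonneg _)]
        _ ≤ _ := ENNReal.ofReal_le_ofReal (by push_cast; exact h3)
    calc ENNReal.ofReal (B / (1 + η)) = 1 / ENNReal.ofReal ((1 + η) / B) := by
          rw [one_div, ← ENNReal.ofReal_inv_of_pos (by positivity), inv_div]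
      _ ≤ _ := by gcongr
  have hlim : Tendsto (fun η : ℝ => ENNReal.ofReal (B / (1 + η))) (nhdsWithin 0 (Ioi 0))
      (nhds (ENNReal.ofReal B)) := by
    refine ENNReal.tendsto_ofReal ?_
    have : Tendsto (fun η : ℝ => B / (1 + η)) (nhds 0) (nhds (B / (1 + 0))) :=
      ContinuousAt.tendsto (ContinuousAt.div (by fun_prop) (by fun_prop) (by norm_num))
    rw [add_zero, div_one] at this
    exact this.mono_left nhdsWithin_le_nhds
  exact le_of_tendsto hlim (by filter_upwards [self_mem_nhdsWithin] with η hη using main η hη)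

/-! ### Inhomogeneous continued fraction expansions -/

/-- Compactness: backward steps inside compact sets give an infinite chain. -/
lemma exists_chain {X : Type*} [TopologicalSpace X] [T2Space X] {K : ℕ → Set X}
    (hK : ∀ n, IsCompact (K n)) (hne : ∀ n, (K n).Nonempty) {R : ℕ → X → X → Prop}
    (hR : ∀ n, IsClosed {p : X × X | R n p.1 p.2})
    (hstep : ∀ n, ∀ q ∈ K (n + 1), ∃ p ∈ K n, R n p q) :
    ∃ z : ℕ → X, (∀ n, z n ∈ K n) ∧ ∀ n, R n (z n) (z (n + 1)) := by
  choose c hc using hne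
  have hfin : ∀ N, ∀ q ∈ K N, ∃ z : ℕ → X, z N = q ∧ (∀ n, z n ∈ K n) ∧
      ∀ n < N, R n (z n) (z (n + 1)) := by
    intro N
    induction N with
    | zero =>
      intro q hq
      refine ⟨Function.update c 0 q, by simp, fun n => ?_, by simp⟩
      rcases eq_or_ne n 0 with rfl | hn
      · simpa using hq
      · simpa [hn] using hc n
    | succ N ih =>
      intro q hq
      obtain ⟨p, hp, hpq⟩ := hstep N q hq
      obtain ⟨z, hz, hzK, hzR⟩ := ih p hp
      refine ⟨Function.update z (N + 1) q, by simp, fun n => ?_, fun n hn => ?_⟩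
      · rcases eq_or_ne n (N + 1) with rfl | hn
        · simpa using hq
        · simpa [hn] using hzK n
      · rcases eq_or_ne n N with rfl | hn'
        · simpa [hz] using hpq
        · have h1 : n ≠ N + 1 := by omega
          have h2 : n + 1 ≠ N + 1 := by omega
          simpa [Function.update_of_ne h1, Function.update_of_ne h2] using hzR n (by omega)
  have hpi : IsCompact (Set.pi univ K) := isCompact_univ_pi hK
  set F : ℕ → Set (ℕ → X) := fun N => Set.pi univ K ∩ {z | ∀ n < N, R n (z n) (z (n + 1))}
  have hcl : ∀ N, IsClosed {z : ℕ → X | ∀ n < N, R n (z n) (z (n + 1))} := by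
    intro N
    simp only [ofPred_forall]
    refine isClosed_iInter fun n => isClosed_iInter fun _ => ?_
    exact (hR n).preimage (f := fun z : ℕ → X => (z n, z (n + 1)))
      ((continuous_apply n).prodMk (continuous_apply (n + 1)))
  obtain ⟨z, hz⟩ := IsCompact.nonempty_iInter_of_sequence_nonempty_isCompact_isClosed F
    (fun N z hz => ⟨hz.1, fun n hn => hz.2 n (by omega)⟩)
    (fun N => by
      obtain ⟨z, -, h1, h2⟩ := hfin N (c N) (hc N)
      exact ⟨z, fun n _ => h1 n, h2⟩)
    (hpi.inter_right (hcl 0)) (fun N => hpi.isClosed.inter (hcl N))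
  rw [mem_iInter] at hz
  exact ⟨z, fun n => (hz 0).1 n (mem_univ n), fun n => (hz (n + 1)).2 n (Nat.lt_succ_self n)⟩

/-- Digits `(a, γ)` for which a step of the expansion contracts towards small values. -/
def NormalDigit (a g : ℤ) : Prop := 4 ≤ |a| ∧ |a| ≤ 11 ∧ 153 + 100 * |g| ≤ 46 * |a|

/-- A sequence of digits: normal ones, and special ones `(A, 4 - A)` placed between `(-6, 0)`
and `(6, 0)`. -/
structure Digits (a g : ℕ → ℤ) (sp : ℕ → Prop) : Prop where
  even : ∀ n, Even (a n + g n)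
  normal : ∀ n, ¬ sp n → NormalDigit (a n) (g n)
  special : ∀ n, sp n → 9 ≤ a n ∧ g n = 4 - a n
  zero : a 0 = -6 ∧ g 0 = 0
  before : ∀ n, sp (n + 1) → a n = -6 ∧ g n = 0
  after : ∀ n, sp n → a (n + 1) = 6 ∧ g (n + 1) = 0
  gap : ∀ n, sp n → ¬ sp (n + 2)

/-- The algebraic relations of a two-sided inhomogeneous expansion. -/
structure Recursion (a g : ℕ → ℤ) (x d y e : ℕ → ℝ) : Prop where
  x_succ : ∀ n, x (n + 1) * (a n - x n) = 1
  d_succ : ∀ n, d (n + 1) = x (n + 1) * (g n + d n)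
  y_eq : ∀ n, y n * (a n - y (n + 1)) = 1
  e_eq : ∀ n, e n = y n * (g n + e (n + 1))

/-- A two-sided inhomogeneous expansion with its initial values and its bounds. -/
structure Expansion (a g : ℕ → ℤ) (sp : ℕ → Prop) (x d y e : ℕ → ℝ) : Prop
    extends Recursion a g x d y e where
  x_zero : x 0 = 0
  d_zero : d 0 = -1
  x_le : ∀ n, |x n| ≤ 27 / 100
  d_le : ∀ n, |x n| + |d n| ≤ 1
  d_good : ∀ n, ¬ sp n → |d (n + 1)| ≤ 2 / 5 ∧ |x (n + 1)| + |d (n + 1)| ≤ 46 / 100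
  y_le : ∀ n, |y n| ≤ 27 / 100
  e_lt : ∀ n, |y n| + |e n| < 1
  e_good : ∀ n, ¬ sp n → |e n| ≤ 2 / 5 ∧ |y n| + |e n| ≤ 46 / 100

lemma Digits.not_sp_zero {a g : ℕ → ℤ} {sp : ℕ → Prop} (h : Digits a g sp) : ¬ sp 0 :=
  fun h0 => by have := (h.special 0 h0).1; have := h.zero.1; omega

lemma Digits.not_sp_before {a g : ℕ → ℤ} {sp : ℕ → Prop} (h : Digits a g sp) {n : ℕ}
    (hn : sp (n + 1)) : ¬ sp n :=
  fun h0 => by have := (h.special n h0).1; have := (h.before n hn).1; omega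

lemma Digits.not_sp_after {a g : ℕ → ℤ} {sp : ℕ → Prop} (h : Digits a g sp) {n : ℕ}
    (hn : sp n) : ¬ sp (n + 1) :=
  fun h0 => by have := (h.special _ h0).1; have := (h.after n hn).1; omega

/-- Here `|u'| ≤ 1 / (|a| - 0.27)`, and `NormalDigit` is what makes `|u'| (1.4 + |g|) ≤ 0.46`; the
bound `|a| ≤ 11` is used for `|d'| ≤ 0.4`. The alternative with `|d| ≤ 1` serves next to special
digits and for the initial value `d 0 = -1`. -/
lemma normal_step {a g : ℤ} {u d u' d' : ℝ} (hu : |u| ≤ 27 / 100) (hN : NormalDigit a g)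
    (hd : |d| ≤ 2 / 5 ∨ |a| = 6 ∧ g = 0 ∧ |d| ≤ 1) (h1 : u' * (a - u) = 1)
    (h2 : d' = u' * (g + d)) :
    |u'| ≤ 27 / 100 ∧ |d'| ≤ 2 / 5 ∧ |u'| + |d'| ≤ 46 / 100 := by
  obtain ⟨ha4, ha11, hag⟩ := hN
  have ha4' : (4 : ℝ) ≤ |(a : ℝ)| := by exact_mod_cast ha4
  have ha11' : |(a : ℝ)| ≤ 11 := by exact_mod_cast ha11
  have hag' : 153 + 100 * |(g : ℝ)| ≤ 46 * |(a : ℝ)| := by exact_mod_cast hag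
  have h3 : |u'| * |a - u| = 1 := by rw [← abs_mul, h1, abs_one]
  have h4 : |(a : ℝ)| - 27 / 100 ≤ |a - u| := by
    have := abs_sub_abs_le_abs_sub (a : ℝ) u
    linarith
  have h5 : |u'| * (|(a : ℝ)| - 27 / 100) ≤ 1 := by
    rw [← h3]; exact mul_le_mul_of_nonneg_left h4 (abs_nonneg _)
  have h6 : |d'| ≤ |u'| * (|(g : ℝ)| + |d|) := by
    rw [h2, abs_mul]; exact mul_le_mul_of_nonneg_left (abs_add_le _ _) (abs_nonneg _)
  have h0 := abs_nonneg u'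
  have h7 := mul_le_mul_of_nonneg_left ha4' h0
  have h8 := mul_le_mul_of_nonneg_left ha11' h0
  have h9 := mul_le_mul_of_nonneg_left hag' h0
  rcases hd with hd | ⟨h10, rfl, hd⟩
  · have h11 := mul_le_mul_of_nonneg_left hd h0
    refine ⟨by linarith, by linarith, by linarith⟩
  · have h12 : |(a : ℝ)| = 6 := by exact_mod_cast h10
    rw [h12] at h5
    have h11 := mul_le_mul_of_nonneg_left hd h0
    simp only [Int.cast_zero, abs_zero, zero_add] at h6
    refine ⟨by linarith, by linarith, by linarith⟩

/-- The sum is `u' (a - 3 - d)`, at most `(a - 2.6) / (a - 0.27)`: below `1`, but with no uniform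
margin. This is why the neighbours of a special digit are `(∓6, 0)`, which absorb a large `d`. -/
lemma special_step {a g : ℤ} {u d u' d' : ℝ} (hu : |u| ≤ 27 / 100) (ha : 9 ≤ a) (hg : g = 4 - a)
    (hd : |d| ≤ 2 / 5) (h1 : u' * (a - u) = 1) (h2 : d' = u' * (g + d)) :
    |u'| ≤ 27 / 100 ∧ |u'| + |d'| < 1 := by
  have ha' : (9 : ℝ) ≤ a := by exact_mod_cast ha
  have hg' : (g : ℝ) = 4 - a := by rw [hg]; push_cast; ring
  have hu' := abs_le.1 hu
  have hd' := abs_le.1 hd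
  have h0 : 0 < u' := pos_of_mul_pos_left (by rw [h1]; exact one_pos) (by linarith)
  have h3 : |d'| = u' * (a - 4 - d) := by
    rw [h2, hg', abs_mul, abs_of_pos h0, abs_of_neg (by linarith)]; ring
  rw [h3, abs_of_pos h0]
  constructor
  · nlinarith
  · nlinarith

/-- The left part of the expansion. -/
noncomputable def leftPart (a g : ℕ → ℤ) : ℕ → ℝ × ℝ
  | 0 => (0, -1)
  | n + 1 => (1 / (a n - (leftPart a g n).1),
      1 / (a n - (leftPart a g n).1) * (g n + (leftPart a g n).2))

lemma Digits.abs_ge {a g : ℕ → ℤ} {sp : ℕ → Prop} (h : Digits a g sp) (n : ℕ) : 4 ≤ |a n| := by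
  by_cases hn : sp n
  · have := (h.special n hn).1
    have := le_abs_self (a n)
    omega
  · exact (h.normal n hn).1

lemma sub_ne_zero_of_digit {a : ℤ} {u : ℝ} (ha : 4 ≤ |a|) (hu : |u| ≤ 27 / 100) :
    (a : ℝ) - u ≠ 0 := by
  intro h0
  have : (4 : ℝ) ≤ |(a : ℝ)| := by exact_mod_cast ha
  rw [sub_eq_zero.1 h0] at this
  linarith

lemma leftPart_bounds {a g : ℕ → ℤ} {sp : ℕ → Prop} (h : Digits a g sp) (n : ℕ) :
    |(leftPart a g n).1| ≤ 27 / 100 ∧ |(leftPart a g n).1| + |(leftPart a g n).2| ≤ 1 ∧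
      ∀ k, n = k + 1 → ¬ sp k →
        |(leftPart a g n).2| ≤ 2 / 5 ∧ |(leftPart a g n).1| + |(leftPart a g n).2| ≤ 46 / 100 := by
  induction n with
  | zero =>
    refine ⟨?_, ?_, fun k hk => by omega⟩ <;> norm_num [leftPart]
  | succ n ih =>
    obtain ⟨ih1, ih2, ih3⟩ := ih
    have hrel : (leftPart a g (n + 1)).1 * (a n - (leftPart a g n).1) = 1 := by
      rw [leftPart, one_div, inv_mul_cancel₀ (sub_ne_zero_of_digit (h.abs_ge n) ih1)]
    have hrel' : (leftPart a g (n + 1)).2 =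
        (leftPart a g (n + 1)).1 * (g n + (leftPart a g n).2) := rfl
    by_cases hn : sp n
    · obtain ⟨ha, hg⟩ := h.special n hn
      have hd : |(leftPart a g n).2| ≤ 2 / 5 := by
        rcases n with _ | k
        · exact absurd hn h.not_sp_zero
        · exact (ih3 k rfl (h.not_sp_before hn)).1
      obtain ⟨h1, h2⟩ := special_step ih1 ha hg hd hrel hrel'
      refine ⟨h1, h2.le, fun k hk hk' => ?_⟩
      obtain rfl : n = k := by omega
      exact absurd hn hk'
    · have hd : |(leftPart a g n).2| ≤ 2 / 5 ∨ |a n| = 6 ∧ g n = 0 ∧ |(leftPart a g n).2| ≤ 1 := by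
        have h1 : |(leftPart a g n).2| ≤ 1 := by
          have := abs_nonneg (leftPart a g n).1
          linarith
        rcases n with _ | k
        · exact Or.inr ⟨by rw [h.zero.1]; rfl, h.zero.2, h1⟩
        · by_cases hk : sp k
          · exact Or.inr ⟨by rw [(h.after k hk).1]; rfl, (h.after k hk).2, h1⟩
          · exact Or.inl (ih3 k rfl hk).1
      obtain ⟨h1, h2, h3⟩ := normal_step ih1 (h.normal n hn) hd hrel hrel'
      exact ⟨h1, by linarith, fun _ _ _ => ⟨h2, h3⟩⟩

/-- The right part is determined from infinity backwards. A backward step maps the compact set of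
allowed pairs at `n + 1` into the one at `n`, so `exists_chain` provides a full solution. The strict
inequality comes from one more backward step. -/
lemma exists_rightPart {a g : ℕ → ℤ} {sp : ℕ → Prop} (h : Digits a g sp) :
    ∃ y e : ℕ → ℝ, (∀ n, y n * (a n - y (n + 1)) = 1) ∧ (∀ n, e n = y n * (g n + e (n + 1))) ∧
      (∀ n, |y n| ≤ 27 / 100) ∧ (∀ n, |y n| + |e n| < 1) ∧
      ∀ n, ¬ sp n → |e n| ≤ 2 / 5 ∧ |y n| + |e n| ≤ 46 / 100 := by
  set K : ℕ → Set (ℝ × ℝ) := fun n => {p | |p.1| ≤ 27 / 100} ∩ {p | |p.1| + |p.2| ≤ 1} ∩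
    {p | ¬ sp n → |p.2| ≤ 2 / 5 ∧ |p.1| + |p.2| ≤ 46 / 100} with hKdef
  have hK : ∀ n, IsCompact (K n) := by
    intro n
    have hbox : IsCompact (Icc (-1 : ℝ) 1 ×ˢ Icc (-1 : ℝ) 1) := isCompact_Icc.prod isCompact_Icc
    refine hbox.of_isClosed_subset ?_ ?_
    · have h1 : IsClosed {p : ℝ × ℝ | |p.1| ≤ 27 / 100} := isClosed_le (by fun_prop) (by fun_prop)
      have h2 : IsClosed {p : ℝ × ℝ | |p.1| + |p.2| ≤ 1} := isClosed_le (by fun_prop) (by fun_prop)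
      refine (h1.inter h2).inter ?_
      by_cases hn : sp n
      · simp [hn]
      · simp only [hn, not_false_eq_true, forall_const]
        have h3 : IsClosed {p : ℝ × ℝ | |p.2| ≤ 2 / 5} := isClosed_le (by fun_prop) (by fun_prop)
        have h4 : IsClosed {p : ℝ × ℝ | |p.1| + |p.2| ≤ 46 / 100} :=
          isClosed_le (by fun_prop) (by fun_prop)
        exact h3.inter h4
    · rintro ⟨p, q⟩ ⟨⟨-, h2⟩, -⟩
      have h3 : |p| + |q| ≤ 1 := h2
      have := abs_nonneg p
      have := abs_nonneg q
      exact ⟨abs_le.1 (by linarith), abs_le.1 (by linarith)⟩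
  have hne : ∀ n, (K n).Nonempty := fun n => ⟨(0, 0), by norm_num [hKdef]⟩
  have hmain : ∀ n, ∀ q ∈ K (n + 1), ∀ p : ℝ × ℝ, p.1 * (a n - q.1) = 1 →
      p.2 = p.1 * (g n + q.2) → p ∈ K n ∧ |p.1| + |p.2| < 1 := by
    rintro n q ⟨⟨hq1, hq2⟩, hq3⟩ p hp1 hp2
    have hq1' : |q.1| ≤ 27 / 100 := hq1
    have hq2' : |q.1| + |q.2| ≤ 1 := hq2
    by_cases hn : sp n
    · obtain ⟨ha, hg⟩ := h.special n hn
      obtain ⟨h1, h2⟩ := special_step hq1' ha hg (hq3 (h.not_sp_after hn)).1 hp1 hp2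
      exact ⟨⟨⟨h1, h2.le⟩, fun h3 => absurd hn h3⟩, h2⟩
    · have hd : |q.2| ≤ 2 / 5 ∨ |a n| = 6 ∧ g n = 0 ∧ |q.2| ≤ 1 := by
        by_cases hn' : sp (n + 1)
        · have := abs_nonneg q.1
          exact Or.inr ⟨by rw [(h.before n hn').1]; rfl, (h.before n hn').2, by linarith⟩
        · exact Or.inl (hq3 hn').1
      obtain ⟨h1, h2, h3⟩ := normal_step hq1' (h.normal n hn) hd hp1 hp2
      have h4 : |p.1| + |p.2| < 1 := by linarith
      exact ⟨⟨⟨h1, h4.le⟩, fun _ => ⟨h2, h3⟩⟩, h4⟩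
  obtain ⟨z, hz, hzR⟩ := exists_chain hK hne
    (R := fun n p q => p.1 * (a n - q.1) = 1 ∧ p.2 = p.1 * (g n + q.2))
    (fun n => (isClosed_eq (by fun_prop) (by fun_prop)).inter
      (isClosed_eq (by fun_prop) (by fun_prop)))
    (fun n q hq => by
      have h1 : 1 / (a n - q.1) * (a n - q.1) = 1 := by
        rw [one_div, inv_mul_cancel₀ (sub_ne_zero_of_digit (h.abs_ge n) hq.1.1)]
      exact ⟨(1 / (a n - q.1), 1 / (a n - q.1) * (g n + q.2)), (hmain n q hq _ h1 rfl).1, h1, rfl⟩)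
  exact ⟨fun n => (z n).1, fun n => (z n).2, fun n => (hzR n).1, fun n => (hzR n).2,
    fun n => (hz n).1.1, fun n => (hmain n _ (hz (n + 1)) _ (hzR n).1 (hzR n).2).2,
    fun n hn => (hz n).2 hn⟩

theorem exists_expansion {a g : ℕ → ℤ} {sp : ℕ → Prop} (h : Digits a g sp) :
    ∃ x d y e : ℕ → ℝ, Expansion a g sp x d y e := by
  obtain ⟨y, e, h1, h2, h3, h4, h5⟩ := exists_rightPart h
  refine ⟨fun n => (leftPart a g n).1, fun n => (leftPart a g n).2, y, e,
    ⟨⟨fun n => ?_, fun n => rfl, h1, h2⟩, rfl, rfl, fun n => (leftPart_bounds h n).1,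
      fun n => (leftPart_bounds h n).2.1, fun n hn => (leftPart_bounds h (n + 1)).2.2 n rfl hn,
      h3, h4, h5⟩⟩
  rw [leftPart, one_div,
    inv_mul_cancel₀ (sub_ne_zero_of_digit (h.abs_ge n) (leftPart_bounds h n).1)]

/-! ### Linear forms along an expansion -/

/-- The change of integer coordinates along an expansion. -/
def orbit (a g : ℕ → ℤ) (p : ℤ × ℤ) : ℕ → ℤ × ℤ
  | 0 => p
  | n + 1 => (-(orbit a g p n).2, (orbit a g p n).1 + a n * (orbit a g p n).2 - g n)

/-- The linear form attached to the left part. -/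
def leftForm (x d : ℕ → ℝ) (q : ℤ × ℤ) (n : ℕ) : ℝ := q.1 + q.2 * x n + d n

/-- The linear form attached to the right part. -/
def rightForm (y e : ℕ → ℝ) (q : ℤ × ℤ) (n : ℕ) : ℝ := q.2 + q.1 * y n - e n

section Forms

variable {a g : ℕ → ℤ} {x d y e : ℕ → ℝ}

lemma Recursion.homogeneous (h : Recursion a g x d y e) : Recursion a 0 x 0 y 0 :=
  ⟨h.x_succ, fun n => by simp, h.y_eq, fun n => by simp⟩

lemma Recursion.left_succ (h : Recursion a g x d y e) (p : ℤ × ℤ) (n : ℕ) :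
    leftForm x d (orbit a g p (n + 1)) (n + 1) =
      x (n + 1) * leftForm x d (orbit a g p n) n := by
  simp only [leftForm, orbit, h.d_succ]
  push_cast
  linear_combination ((orbit a g p n).2 : ℝ) * (h.x_succ n)

lemma Recursion.right_eq (h : Recursion a g x d y e) (p : ℤ × ℤ) (n : ℕ) :
    rightForm y e (orbit a g p n) n = y n * rightForm y e (orbit a g p (n + 1)) (n + 1) := by
  simp only [rightForm, orbit]
  rw [h.e_eq n]
  push_cast
  linear_combination -((orbit a g p n).2 : ℝ) * (h.y_eq n)

lemma Recursion.y_ne_zero (h : Recursion a g x d y e) (n : ℕ) : y n ≠ 0 := by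
  intro h0
  have := h.y_eq n
  rw [h0, zero_mul] at this
  exact zero_ne_one this

lemma Recursion.x_ne_zero (h : Recursion a g x d y e) (n : ℕ) : x (n + 1) ≠ 0 := by
  intro h0
  have := h.x_succ n
  rw [h0, zero_mul] at this
  exact zero_ne_one this

/-- From one level to the next the left form is multiplied by `x (n + 1)` and the right form divided
by `y n`, and `1 - x n * y n` changes by the same ratio. The second identity mixes two consecutive
levels, where `(1 - x n * y n) / y n` is `a n - x n - y (n + 1)`. -/
lemma Recursion.product_eq (h : Recursion a g x d y e) (h0 : x 0 = 0) (p : ℤ × ℤ) (n : ℕ) :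
    leftForm x d p 0 * rightForm y e p 0 * (1 - x n * y n) =
      leftForm x d (orbit a g p n) n * rightForm y e (orbit a g p n) n ∧
    leftForm x d p 0 * rightForm y e p 0 * (a n - x n - y (n + 1)) =
      leftForm x d (orbit a g p n) n * rightForm y e (orbit a g p (n + 1)) (n + 1) := by
  have hstep : ∀ n, leftForm x d p 0 * rightForm y e p 0 * (1 - x n * y n) =
      leftForm x d (orbit a g p n) n * rightForm y e (orbit a g p n) n →
      leftForm x d p 0 * rightForm y e p 0 * (a n - x n - y (n + 1)) =
      leftForm x d (orbit a g p n) n * rightForm y e (orbit a g p (n + 1)) (n + 1) := by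
    intro n hn
    rw [h.right_eq p n] at hn
    refine mul_left_cancel₀ (h.y_ne_zero n) ?_
    linear_combination hn + leftForm x d p 0 * rightForm y e p 0 * h.y_eq n
  induction n with
  | zero =>
    have h1 : leftForm x d p 0 * rightForm y e p 0 * (1 - x 0 * y 0) =
      leftForm x d (orbit a g p 0) 0 * rightForm y e (orbit a g p 0) 0 := by
      rw [h0, zero_mul, sub_zero, mul_one]; rfl
    exact ⟨h1, hstep 0 h1⟩
  | succ n ih =>
    have h1 : leftForm x d p 0 * rightForm y e p 0 * (1 - x (n + 1) * y (n + 1)) =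
      leftForm x d (orbit a g p (n + 1)) (n + 1) *
        rightForm y e (orbit a g p (n + 1)) (n + 1) := by
      rw [h.left_succ]
      linear_combination x (n + 1) * ih.2 - leftForm x d p 0 * rightForm y e p 0 * h.x_succ n
    exact ⟨h1, hstep _ h1⟩

/-- The first time at which the second coordinate dominates. -/
lemma exists_level (a g : ℕ → ℤ) (p : ℤ × ℤ) :
    ∃ m, |(orbit a g p m).1| ≤ |(orbit a g p m).2| ∧
      ∀ k, m = k + 1 → |(orbit a g p k).2| < |(orbit a g p k).1| := by
  have hex : ∃ m, |(orbit a g p m).1| ≤ |(orbit a g p m).2| := by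
    -- The new first coordinate is minus the old second one, so its absolute value would decrease
    -- forever.
    by_contra! hlt
    have h1 : ∀ m : ℕ, |(orbit a g p m).1| + m ≤ |p.1| := by
      intro m
      induction m with
      | zero => simp [orbit]
      | succ m ih =>
        have h2 := hlt m
        have h3 : |(orbit a g p (m + 1)).1| = |(orbit a g p m).2| := by simp [orbit]
        push_cast
        omega
    have h2 := h1 (|p.1| + 1).toNat
    have h3 := abs_nonneg (orbit a g p (|p.1| + 1).toNat).1
    have h4 := abs_nonneg p.1
    omega
  classical
  refine ⟨Nat.find hex, Nat.find_spec hex, fun k hk => ?_⟩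
  exact not_le.1 (Nat.find_min hex (by omega))

end Forms

/-! ### Lower bounds for the products of linear forms -/

section Bounds

variable {a g : ℕ → ℤ} {sp : ℕ → Prop} {x d y e : ℕ → ℝ}

/-- Parity is preserved because `a + g` is even. It gives the gap of `2` used in `left_ge` and the
alternative between corners `(±1, ±1)` and `|L| ≥ 3`. -/
lemma orbit_odd (h : Digits a g sp) {p : ℤ × ℤ} (h1 : Odd p.1) (h2 : Odd p.2) (n : ℕ) :
    Odd (orbit a g p n).1 ∧ Odd (orbit a g p n).2 := by
  induction n with
  | zero => exact ⟨h1, h2⟩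
  | succ n ih =>
    obtain ⟨⟨r, hr⟩, ⟨s, hs⟩⟩ := ih
    obtain ⟨t, ht⟩ := h.even n
    refine ⟨⟨-s - 1, ?_⟩, ⟨r + a n * s + t - g n, ?_⟩⟩
    · simp only [orbit]; omega
    · simp only [orbit]
      rw [hr, hs]
      linear_combination ht

lemma orbit_fst_abs (a g : ℕ → ℤ) (p : ℤ × ℤ) (n : ℕ) :
    |(orbit a g p (n + 1)).1| = |(orbit a g p n).2| := by simp [orbit]

lemma left_ge {J L : ℤ} {u v : ℝ} (hJ : Odd J) (hL : Odd L) (hlt : |L| < |J|) (hu : |u| ≤ 1) :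
    3 - |u| - |v| ≤ |(J : ℝ) + L * u + v| := by
  have h1 : |L| + 2 ≤ |J| ∧ 1 ≤ |L| := by
    obtain ⟨r, rfl⟩ := hJ
    obtain ⟨s, rfl⟩ := hL
    rcases abs_cases (2 * r + 1) with ⟨h1, h2⟩ | ⟨h1, h2⟩ <;>
    rcases abs_cases (2 * s + 1) with ⟨h3, h4⟩ | ⟨h3, h4⟩ <;> omega
  have h2 : |(L : ℝ)| + 2 ≤ |(J : ℝ)| := by exact_mod_cast h1.1
  have h3 : 1 ≤ |(L : ℝ)| := by exact_mod_cast h1.2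
  have h4 : |(J : ℝ)| ≤ |(J : ℝ) + L * u + v| + |(L : ℝ)| * |u| + |v| := by
    rw [← abs_mul]
    have := abs_sub (J + L * u + v : ℝ) (L * u + v)
    have h6 := abs_add_le (L * u : ℝ) v
    have h5 : (J + L * u + v : ℝ) - (L * u + v) = J := by ring
    rw [h5] at this
    linarith
  nlinarith

lemma right_ge {J L : ℤ} {u v : ℝ} (hle : |J| ≤ |L|) :
    |(L : ℝ)| * (1 - |u|) - |v| ≤ |(L : ℝ) + J * u - v| := by
  have h2 : |(J : ℝ)| ≤ |(L : ℝ)| := by exact_mod_cast hle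
  have h4 : |(L : ℝ)| ≤ |(L : ℝ) + J * u - v| + |(J : ℝ)| * |u| + |v| := by
    rw [← abs_mul]
    have := abs_sub (L + J * u - v : ℝ) (J * u - v)
    have h6 := abs_sub (J * u : ℝ) v
    have h5 : (L + J * u - v : ℝ) - (J * u - v) = L := by ring
    rw [h5] at this
    linarith
  have := mul_le_mul_of_nonneg_right h2 (abs_nonneg u)
  linarith

lemma odd_abs_cases {J L : ℤ} (hJ : Odd J) (hL : Odd L) (hle : |J| ≤ |L|) :
    3 ≤ |L| ∨ ((J = 1 ∨ J = -1) ∧ (L = 1 ∨ L = -1)) := by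
  obtain ⟨r, rfl⟩ := hJ
  obtain ⟨s, rfl⟩ := hL
  rcases abs_cases (2 * r + 1) with ⟨h1, h2⟩ | ⟨h1, h2⟩ <;>
  rcases abs_cases (2 * s + 1) with ⟨h3, h4⟩ | ⟨h3, h4⟩ <;> omega

/-- The left coefficient at a special digit. -/
def leftCoef (x d : ℕ → ℝ) (n : ℕ) : ℝ := 1 - x n + d n

/-- The right coefficient at a special digit. -/
def rightCoef (y e : ℕ → ℝ) (n : ℕ) : ℝ := 1 - y (n + 1) + e (n + 1)

lemma inv_six_bounds {u v : ℝ} (hu : |u| ≤ 27 / 100) (h : v * (6 - u) = 1) :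
    159 / 1000 ≤ v ∧ v ≤ 175 / 1000 := by
  have hu' := abs_le.1 hu
  have hv : 0 < v := pos_of_mul_pos_left (by rw [h]; exact one_pos) (by linarith)
  constructor <;> nlinarith

lemma left_special (h : Digits a g sp) (hx : Expansion a g sp x d y e) {n : ℕ} (hn : sp n) :
    -(175 / 1000) ≤ x n ∧ x n ≤ -(159 / 1000) ∧ |d n| ≤ 175 / 1000 ∧ |x n| + |d n| ≤ 46 / 100 := by
  rcases n with _ | k
  · exact absurd hn h.not_sp_zero
  obtain ⟨ha, hg⟩ := h.before k hn
  have h1 := hx.x_succ k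
  have h2 := hx.d_succ k
  rw [ha] at h1
  rw [hg] at h2
  push_cast at h1 h2
  have h3 : -x (k + 1) * (6 - -x k) = 1 := by linarith
  obtain ⟨h4, h5⟩ := inv_six_bounds (by rw [abs_neg]; exact hx.x_le k) h3
  refine ⟨by linarith, by linarith, ?_, (hx.d_good k (h.not_sp_before hn)).2⟩
  rw [h2, zero_add, abs_mul]
  have h6 : |d k| ≤ 1 := by linarith [hx.d_le k, abs_nonneg (x k)]
  have h7 : |x (k + 1)| ≤ 175 / 1000 := abs_le.2 ⟨by linarith, by linarith⟩
  nlinarith [abs_nonneg (x (k + 1)), abs_nonneg (d k)]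

/-- The digit after a special one is `(6, 0)`, and by `gap` the next one is not special; thus `e (n
+ 2)` is at most `2/5`, and it is multiplied by `y (n + 1)`. -/
lemma right_special (h : Digits a g sp) (hx : Expansion a g sp x d y e) {n : ℕ} (hn : sp n) :
    159 / 1000 ≤ y (n + 1) ∧ y (n + 1) ≤ 175 / 1000 ∧ |e (n + 1)| ≤ 7 / 100 := by
  obtain ⟨ha, hg⟩ := h.after n hn
  have h1 := hx.y_eq (n + 1)
  have h2 := hx.e_eq (n + 1)
  rw [ha] at h1
  rw [hg] at h2
  push_cast at h1 h2
  obtain ⟨h4, h5⟩ := inv_six_bounds (hx.y_le _) h1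
  refine ⟨h4, h5, ?_⟩
  rw [h2, zero_add, abs_mul]
  have h6 := (hx.e_good _ (h.gap n hn)).1
  have h7 : |y (n + 1)| ≤ 175 / 1000 := abs_le.2 ⟨by linarith, by linarith⟩
  nlinarith [abs_nonneg (y (n + 1)), abs_nonneg (e (n + 1 + 1))]

lemma coef_bounds (h : Digits a g sp) (hx : Expansion a g sp x d y e) {n : ℕ} (hn : sp n) :
    98 / 100 ≤ leftCoef x d n ∧ leftCoef x d n ≤ 136 / 100 ∧ 75 / 100 ≤ rightCoef y e n ∧
      rightCoef y e n ≤ 92 / 100 := by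
  obtain ⟨h1, h2, h3, -⟩ := left_special h hx hn
  obtain ⟨h4, h5, h6⟩ := right_special h hx hn
  rw [abs_le] at h3 h6
  unfold leftCoef rightCoef
  refine ⟨?_, ?_, ?_, ?_⟩ <;> linarith

lemma abs_mul_ge {u v s t : ℝ} (hs : 0 ≤ s) (ht : 0 ≤ t) (hu : s ≤ |u|) (hv : t ≤ |v|) :
    s * t ≤ |u * v| := by
  rw [abs_mul]; exact mul_le_mul hu hv ht (hs.trans hu)

/-- The corner estimate just after a special digit. -/
lemma corner_after_special {A : ℤ} {u v y e S T : ℝ} {J L : ℤ} (hA : 9 ≤ A)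
    (hS : S = 1 - u + v) (hT : T = 1 - y + e) (hu1 : -(175 / 1000) ≤ u) (hu2 : u ≤ -(159 / 1000))
    (hv : |v| ≤ 175 / 1000) (hy1 : 159 / 1000 ≤ y) (hy2 : y ≤ 175 / 1000) (he : |e| ≤ 7 / 100)
    (hJ : J = 1 ∨ J = -1) (hL : L = 1 ∨ L = -1) :
    (2 + S) * T ≤ |((L + A * J + 4 - A : ℤ) + (-J : ℤ) * u + v) * (L + J * y - e)| := by
  have hA' : (9 : ℝ) ≤ A := by exact_mod_cast hA
  rw [abs_le] at hv he
  have hS0 : 0 ≤ 2 + S := by linarith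
  have hT0 : 0 ≤ T := by linarith
  rcases hJ with rfl | rfl <;> rcases hL with rfl | rfl <;> push_cast
  -- For `J = 1` the digit `A` cancels and the previous first coordinate is `5` or `3`; the latter
  -- gives equality. For `J = -1` that coordinate is at most `5 - 2 A ≤ -13`, and the product is far
  -- larger.
  · refine abs_mul_ge hS0 hT0 (le_abs.2 (Or.inl ?_)) (le_abs.2 (Or.inl ?_)) <;> linarith
  · refine abs_mul_ge hS0 hT0 (le_abs.2 (Or.inl ?_)) (le_abs.2 (Or.inr ?_)) <;> linarith
  · refine le_trans ?_ (abs_mul_ge (s := 12) (t := 75 / 100) (by norm_num) (by norm_num)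
      (le_abs.2 (Or.inr ?_)) (le_abs.2 (Or.inl ?_)))
    · nlinarith
    · linarith
    · linarith
  · refine le_trans ?_ (abs_mul_ge (s := 12) (t := 75 / 100) (by norm_num) (by norm_num)
      (le_abs.2 (Or.inr ?_)) (le_abs.2 (Or.inr ?_)))
    · nlinarith
    · linarith
    · linarith

/-- The corner estimate just before a special digit. -/
lemma corner_before_special {A : ℤ} {u v y e S T : ℝ} {J L : ℤ} (hA : 9 ≤ A)
    (hS : S = 1 - u + v) (hT : T = 1 - y + e) (hu1 : -(175 / 1000) ≤ u) (hu2 : u ≤ -(159 / 1000))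
    (hv : |v| ≤ 175 / 1000) (hy1 : 159 / 1000 ≤ y) (hy2 : y ≤ 175 / 1000) (he : |e| ≤ 7 / 100)
    (hJ : J = 1 ∨ J = -1) (hL : L = 1 ∨ L = -1) :
    (2 + S) * T ≤ |(J + L * u + v) * ((J + A * L - (4 - A) : ℤ) + (-L : ℤ) * y - e)| := by
  have hA' : (9 : ℝ) ≤ A := by exact_mod_cast hA
  rw [abs_le] at hv he
  have hS1 : 98 / 100 ≤ S := by linarith
  have hS2 : S ≤ 136 / 100 := by linarith
  have hT1 : 75 / 100 ≤ T := by linarith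
  have hT2 : T ≤ 92 / 100 := by linarith
  rcases hL with rfl | rfl <;> rcases hJ with rfl | rfl <;> push_cast
  · refine le_trans ?_ (abs_mul_ge (s := 65 / 100) (t := 12) (by norm_num) (by norm_num)
      (le_abs.2 (Or.inl ?_)) (le_abs.2 (Or.inl ?_)))
    · nlinarith
    · linarith
    · linarith
  · refine le_trans ?_ (abs_mul_ge (s := 65 / 100) (t := 12) (by norm_num) (by norm_num)
      (le_abs.2 (Or.inr ?_)) (le_abs.2 (Or.inl ?_)))
    · nlinarith
    · linarith
    · linarith
  -- `S (2 + T) ≥ (2 + S) T` means `S ≥ T`, which the numerical bounds ensure.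
  · refine le_trans ?_ (abs_mul_ge (s := S) (t := 2 + T) (by linarith) (by linarith)
      (le_abs.2 (Or.inl ?_)) (le_abs.2 (Or.inr ?_)))
    · nlinarith
    · linarith
    · linarith
  -- The inequality reduces to `S (2 + T) ≤ 4`; the bounds `1.36` and `0.92` give `3.98`.
  · refine le_trans ?_ (abs_mul_ge (s := 2 - S) (t := 4 + T) (by linarith) (by linarith)
      (le_abs.2 (Or.inr ?_)) (le_abs.2 (Or.inr ?_)))
    · nlinarith
    · linarith
    · linarith

lemma digit_abs_le (h : Digits a g sp) {n : ℕ} (hn : ¬ sp n) : |(a n : ℝ)| ≤ 11 := by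
  exact_mod_cast (h.normal n hn).2.1

lemma Expansion.denom_abs_le (hx : Expansion a g sp x d y e) (n : ℕ) :
    |(a n : ℝ) - x n - y (n + 1)| ≤ |(a n : ℝ)| + 54 / 100 := by
  have h1 := abs_sub ((a n : ℝ) - x n) (y (n + 1))
  have h2 := abs_sub (a n : ℝ) (x n)
  linarith [hx.x_le n, hx.y_le (n + 1)]

lemma Expansion.denom_pos (h : Digits a g sp) (hx : Expansion a g sp x d y e) {n : ℕ} (hn : sp n) :
    0 < (a n : ℝ) - x n - y (n + 1) := by
  have : (9 : ℝ) ≤ a n := by exact_mod_cast (h.special n hn).1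
  linarith [abs_le.1 (hx.x_le n), abs_le.1 (hx.y_le (n + 1))]

/-- Lower bound for the product of inhomogeneous forms with odd coefficients. -/
theorem inhomogeneous_bound (h : Digits a g sp) (hx : Expansion a g sp x d y e) {p : ℤ × ℤ}
    (hp1 : Odd p.1) (hp2 : Odd p.2) {k : ℕ}
    (hk : |(orbit a g p k).2| < |(orbit a g p k).1|)
    (hk' : |(orbit a g p (k + 1)).1| ≤ |(orbit a g p (k + 1)).2|) :
    27 / 100 ≤ |leftForm x d p 0 * rightForm y e p 0| ∨
      ∃ n, k ≤ n ∧ sp n ∧ (2 + leftCoef x d n) * rightCoef y e n ≤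
        |leftForm x d p 0 * rightForm y e p 0| * (a n - x n - y (n + 1)) := by
  obtain ⟨hJ, hL⟩ := orbit_odd h hp1 hp2 k
  obtain ⟨hJ', hL'⟩ := orbit_odd h hp1 hp2 (k + 1)
  set Q := leftForm x d p 0 * rightForm y e p 0
  have hX : 3 - |x k| - |d k| ≤ |leftForm x d (orbit a g p k) k| :=
    left_ge hJ hL hk (by linarith [hx.x_le k])
  have hY : |((orbit a g p (k + 1)).2 : ℝ)| * (1 - |y (k + 1)|) - |e (k + 1)| ≤
      |rightForm y e (orbit a g p (k + 1)) (k + 1)| := right_ge hk'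
  have hprod := (hx.toRecursion.product_eq hx.x_zero p k).2
  have hy := hx.y_le (k + 1)
  have hcases := odd_abs_cases hJ' hL' hk'
  have hnoncorner : 3 ≤ |(orbit a g p (k + 1)).2| →
      3 * (1 - |y (k + 1)|) - |e (k + 1)| ≤
        |rightForm y e (orbit a g p (k + 1)) (k + 1)| := by
    intro h3
    have h3' : (3 : ℝ) ≤ |((orbit a g p (k + 1)).2 : ℝ)| := by exact_mod_cast h3
    nlinarith
  by_cases hsp : sp k
  · refine Or.inr ⟨k, le_rfl, hsp, ?_⟩
    obtain ⟨h1, h2, h3, h3'⟩ := left_special h hx hsp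
    obtain ⟨h4, h5, h6⟩ := right_special h hx hsp
    obtain ⟨hA, hg⟩ := h.special k hsp
    have hpos := hx.denom_pos h hsp
    rw [← abs_of_pos hpos, ← abs_mul, hprod]
    rcases hcases with hc | ⟨hc1, hc2⟩
    · obtain ⟨hs1, hs2, ht1, ht2⟩ := coef_bounds h hx hsp
      have h7 := hnoncorner hc
      have h8 := (hx.e_good _ (h.not_sp_after hsp)).2
      refine le_trans ?_ (abs_mul_ge (s := 254 / 100) (t := 2) (by norm_num) (by norm_num)
        (by linarith) (by linarith))
      nlinarith
    · have h7 := corner_after_special hA (S := leftCoef x d k) (T := rightCoef y e k) rfl rfl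
        h1 h2 h3 h4 h5 h6 hc1 hc2
      have h8 : (orbit a g p (k + 1)).2 + a k * (orbit a g p (k + 1)).1 + 4 - a k =
          (orbit a g p k).1 := by
        simp only [orbit, hg]; ring
      have h9 : -(orbit a g p (k + 1)).1 = (orbit a g p k).2 := by simp [orbit]
      rw [h8, h9] at h7
      exact h7
  by_cases hsp' : sp (k + 1)
  · rcases hcases with hc | ⟨hc1, hc2⟩
    · left
      have h7 := hnoncorner hc
      have h8 := hx.e_lt (k + 1)
      have h9 : (2 : ℝ) * (146 / 100) ≤ |Q * (a k - x k - y (k + 1))| := by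
        rw [hprod]
        exact abs_mul_ge (by norm_num) (by norm_num) (by linarith [hx.d_le k]) (by linarith)
      have h10 := hx.denom_abs_le k
      rw [(h.before k hsp').1] at h9 h10
      rw [abs_mul] at h9
      norm_num at h10 h9
      nlinarith [abs_nonneg Q]
    · refine Or.inr ⟨k + 1, by omega, hsp', ?_⟩
      obtain ⟨h1, h2, h3, h3'⟩ := left_special h hx hsp'
      obtain ⟨h4, h5, h6⟩ := right_special h hx hsp'
      obtain ⟨hA, hg⟩ := h.special _ hsp'
      have hpos := hx.denom_pos h hsp'
      rw [← abs_of_pos hpos, ← abs_mul, (hx.toRecursion.product_eq hx.x_zero p (k + 1)).2]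
      have h7 := corner_before_special hA (S := leftCoef x d (k + 1))
        (T := rightCoef y e (k + 1)) rfl rfl h1 h2 h3 h4 h5 h6 hc1 hc2
      rw [← hg] at h7
      exact h7
  · left
    have hd := (hx.d_good k hsp).2
    have he := (hx.e_good _ hsp').2
    rcases hcases with hc | ⟨hc1, hc2⟩
    · have h7 := hnoncorner hc
      -- With `|a k| ≤ 11` this gives `|Q| ≥ 4 / 11.54`, above `0.27`.
      have h9 : (2 : ℝ) * 2 ≤ |Q * (a k - x k - y (k + 1))| := by
        rw [hprod]
        exact abs_mul_ge (by norm_num) (by norm_num) (by linarith [hx.d_le k]) (by linarith)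
      have h10 := hx.denom_abs_le k
      have h11 := digit_abs_le h hsp
      rw [abs_mul] at h9
      nlinarith [abs_nonneg Q]
    · have h1 : |((orbit a g p (k + 1)).1 : ℝ)| = 1 := by
        rcases hc1 with hc | hc <;> rw [hc] <;> norm_num
      have h2 : |((orbit a g p (k + 1)).2 : ℝ)| = 1 := by
        rcases hc2 with hc | hc <;> rw [hc] <;> norm_num
      rw [h2] at hY
      have hX' : |((orbit a g p (k + 1)).1 : ℝ)| * (1 - |x (k + 1)|) - |-d (k + 1)| ≤
          |((orbit a g p (k + 1)).1 : ℝ) + (orbit a g p (k + 1)).2 * x (k + 1) - -d (k + 1)| :=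
        right_ge (by
          have : |((orbit a g p (k + 1)).2 : ℝ)| ≤ |((orbit a g p (k + 1)).1 : ℝ)| := by
            rw [h1, h2]
          exact_mod_cast this)
      rw [h1, abs_neg, sub_neg_eq_add] at hX'
      -- The tightest case: `0.54² / (1 + 0.27²)` is just above `0.27`.
      have h9 : (54 / 100 : ℝ) * (54 / 100) ≤ |Q * (1 - x (k + 1) * y (k + 1))| := by
        rw [(hx.toRecursion.product_eq hx.x_zero p (k + 1)).1]
        exact abs_mul_ge (by norm_num) (by norm_num) (by unfold leftForm; linarith) (by linarith)
      have h10 : |1 - x (k + 1) * y (k + 1)| ≤ 1 + 27 / 100 * (27 / 100) := by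
        have h11 := abs_sub 1 (x (k + 1) * y (k + 1))
        rw [abs_one, abs_mul] at h11
        have := mul_le_mul (hx.x_le (k + 1)) hy (abs_nonneg _) (by norm_num)
        linarith
      rw [abs_mul] at h9
      nlinarith [abs_nonneg Q]

/-- Lower bound for the product of homogeneous forms. -/
theorem homogeneous_bound (hx : Expansion a g sp x d y e) {p : ℤ × ℤ} (hp : p.1 ≠ 0) :
    73 / 100 ≤ |leftForm x 0 p 0 * rightForm y 0 p 0| ∨
      ∃ k, 1 ≤ |leftForm x 0 p 0 * rightForm y 0 p 0| * |a k - x k - y (k + 1)| := by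
  have hrec := hx.toRecursion.homogeneous
  obtain ⟨m, hm, hm'⟩ := exists_level a 0 p
  have hne : ∀ n, orbit a 0 p n ≠ 0 := by
    intro n
    induction n with
    | zero => exact fun h0 => hp (by rw [orbit] at h0; rw [h0]; rfl)
    | succ n ih =>
      intro h0
      apply ih
      have h1 := congrArg Prod.fst h0
      have h2 := congrArg Prod.snd h0
      simp only [orbit, Prod.fst_zero, Prod.snd_zero, neg_eq_zero, Pi.zero_apply, sub_zero] at h1 h2
      rw [h1, mul_zero, add_zero] at h2
      exact Prod.ext h2 h1
  have hL : 1 ≤ |(orbit a 0 p m).2| := by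
    refine Int.one_le_abs fun h0 => ?_
    rw [h0, abs_zero] at hm
    exact hne m (Prod.ext (abs_nonpos_iff.1 hm) h0)
  have hL' : (1 : ℝ) ≤ |((orbit a 0 p m).2 : ℝ)| := by exact_mod_cast hL
  have hY : |((orbit a 0 p m).2 : ℝ)| * (1 - |y m|) - |(0 : ℝ)| ≤
      |rightForm y 0 (orbit a 0 p m) m| := right_ge hm
  rw [abs_zero, sub_zero] at hY
  have hy := hx.y_le m
  rcases m with _ | k
  · left
    have h1 : (1 : ℝ) ≤ |leftForm x 0 p 0| := by
      have : (1 : ℝ) ≤ |(p.1 : ℝ)| := by exact_mod_cast Int.one_le_abs hp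
      simpa [leftForm, hx.x_zero] using this
    have h2 := abs_mul_ge (s := 1) (t := 73 / 100) (by norm_num) (by norm_num) h1
      (show 73 / 100 ≤ |rightForm y 0 p 0| by
        change _ ≤ |rightForm y 0 (orbit a 0 p 0) 0|
        nlinarith)
    linarith
  · right
    refine ⟨k, ?_⟩
    rw [← abs_mul, (hrec.product_eq hx.x_zero p k).2]
    have hk := hm' k rfl
    have hx' := hx.x_le k
    have h1 : |((orbit a 0 p k).1 : ℝ)| * (1 - |x k|) + |x k| ≤
        |leftForm x 0 (orbit a 0 p k) k| := by
      have h2 : |((orbit a 0 p k).2 : ℝ)| + 1 ≤ |((orbit a 0 p k).1 : ℝ)| := by exact_mod_cast hk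
      have h3 : |((orbit a 0 p k).1 : ℝ)| ≤ |leftForm x 0 (orbit a 0 p k) k| +
          |((orbit a 0 p k).2 : ℝ)| * |x k| := by
        rw [← abs_mul]
        have := abs_sub (leftForm x 0 (orbit a 0 p k) k) ((orbit a 0 p k).2 * x k)
        have h5 : leftForm x 0 (orbit a 0 p k) k - (orbit a 0 p k).2 * x k =
          (orbit a 0 p k).1 := by simp [leftForm]
        rwa [h5] at this
      nlinarith [abs_nonneg (x k)]
    have hfst := orbit_fst_abs a 0 p k
    -- Either the left form is at least `1.73`, or the point is `(±1, 0)` and the next one `(0,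
    -- ±1)`, where both forms are at least `1`.
    rcases (by omega : 2 ≤ |(orbit a 0 p k).1| ∨ |(orbit a 0 p k).1| ≤ 1) with h2 | h2
    · have h2' : (2 : ℝ) ≤ |((orbit a 0 p k).1 : ℝ)| := by exact_mod_cast h2
      refine le_trans ?_ (abs_mul_ge (s := 173 / 100) (t := 73 / 100) (by norm_num) (by norm_num)
        (by nlinarith) (by nlinarith))
      norm_num
    · have h3 : (orbit a 0 p k).2 = 0 := abs_nonpos_iff.1 (by omega)
      have h4 : (1 : ℝ) ≤ |((orbit a 0 p k).1 : ℝ)| := by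
        have := abs_nonneg (orbit a 0 p k).2
        exact_mod_cast (by omega : 1 ≤ |(orbit a 0 p k).1|)
      have h5 : (orbit a 0 p (k + 1)).1 = 0 := by simp [orbit, h3]
      have h6 : (1 : ℝ) ≤ |rightForm y 0 (orbit a 0 p (k + 1)) (k + 1)| := by
        simpa [rightForm, h5] using hL'
      have := abs_mul_ge (s := 1) (t := 1) (by norm_num) (by norm_num)
        (show 1 ≤ |leftForm x 0 (orbit a 0 p k) k| by nlinarith) h6
      linarith

lemma Expansion.right_pos (h : Digits a g sp) (hx : Expansion a g sp x d y e) {p : ℤ × ℤ}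
    (hp1 : Odd p.1) (hp2 : Odd p.2) {m : ℕ}
    (hm : |(orbit a g p m).1| ≤ |(orbit a g p m).2|) :
    1 - |y m| - |e m| ≤ |rightForm y e (orbit a g p m) m| := by
  have hY : |((orbit a g p m).2 : ℝ)| * (1 - |y m|) - |e m| ≤
      |rightForm y e (orbit a g p m) m| := right_ge hm
  have hL : (1 : ℝ) ≤ |((orbit a g p m).2 : ℝ)| := by
    have h0 := (orbit_odd h hp1 hp2 m).2
    have h1 : (orbit a g p m).2 ≠ 0 := fun h2 => by rw [h2] at h0; exact absurd h0 (by decide)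
    exact_mod_cast Int.one_le_abs h1
  have := hx.y_le m
  nlinarith

/-- The right form with odd coefficients does not vanish. -/
theorem right_ne_zero (h : Digits a g sp) (hx : Expansion a g sp x d y e) {p : ℤ × ℤ}
    (hp1 : Odd p.1) (hp2 : Odd p.2) : rightForm y e p 0 ≠ 0 := by
  intro h0
  have h1 : ∀ n, rightForm y e (orbit a g p n) n = 0 := by
    intro n
    induction n with
    | zero => exact h0
    | succ n ih =>
      rw [hx.right_eq] at ih
      exact (mul_eq_zero.1 ih).resolve_left (hx.y_ne_zero n)
  obtain ⟨m, hm, -⟩ := exists_level a g p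
  have h2 := hx.right_pos h hp1 hp2 hm
  rw [h1, abs_zero] at h2
  linarith [hx.e_lt m]

/-- When the left form is large, the level is large or the product is. -/
theorem exists_large (h : Digits a g sp) (hx : Expansion a g sp x d y e) (N : ℕ) :
    ∃ K : ℝ, ∀ p : ℤ × ℤ, Odd p.1 → Odd p.2 → K ≤ |leftForm x d p 0| → ∀ m ≤ N,
      |(orbit a g p m).1| ≤ |(orbit a g p m).2| →
      1 ≤ |leftForm x d p 0 * rightForm y e p 0| := by
  have hstep : ∀ m, ∃ K : ℝ, 0 ≤ K ∧ ∀ p : ℤ × ℤ, Odd p.1 → Odd p.2 →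
      K ≤ |leftForm x d p 0| → |(orbit a g p m).1| ≤ |(orbit a g p m).2| →
      1 ≤ |leftForm x d p 0 * rightForm y e p 0| := by
    intro m
    have hc : ∃ c > 0, ∀ p, |leftForm x d (orbit a g p m) m| = c * |leftForm x d p 0| := by
      induction m with
      | zero => exact ⟨1, one_pos, fun p => by simp [orbit]⟩
      | succ m ih =>
        obtain ⟨c, hc, hc'⟩ := ih
        refine ⟨|x (m + 1)| * c, mul_pos (abs_pos.2 (hx.x_ne_zero m)) hc, fun p => ?_⟩
        rw [hx.left_succ, abs_mul, hc', mul_assoc]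
    obtain ⟨c, hc, hc'⟩ := hc
    have hs : 0 < 1 - |y m| - |e m| := by linarith [hx.e_lt m]
    refine ⟨2 / (c * (1 - |y m| - |e m|)), by positivity, fun p hp1 hp2 hK hm => ?_⟩
    rw [div_le_iff₀ (by positivity)] at hK
    have h1 := hx.right_pos h hp1 hp2 hm
    have h2 := congrArg abs (hx.toRecursion.product_eq hx.x_zero p m).1
    rw [abs_mul, abs_mul (leftForm x d (orbit a g p m) m), hc'] at h2
    have h3 : |1 - x m * y m| ≤ 2 := by
      have h11 := abs_sub 1 (x m * y m)
      rw [abs_one, abs_mul] at h11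
      have := mul_le_mul (hx.x_le m) (hx.y_le m) (abs_nonneg _) (by norm_num)
      linarith
    have h4 : 2 ≤ c * |leftForm x d p 0| * |rightForm y e (orbit a g p m) m| := by
      have := mul_le_mul_of_nonneg_left h1
        (mul_nonneg hc.le (abs_nonneg (leftForm x d p 0)))
      linarith
    rw [← h2] at h4
    have h5 := mul_le_mul_of_nonneg_left h3 (abs_nonneg (leftForm x d p 0 * rightForm y e p 0))
    linarith
  choose K hK0 hK using hstep
  refine ⟨∑ m ∈ Finset.range (N + 1), K m, fun p hp1 hp2 hp m hm hle =>
    hK m p hp1 hp2 (le_trans ?_ hp) hle⟩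
  exact Finset.single_le_sum (fun i _ => hK0 i) (Finset.mem_range.2 (by omega))

/-- Every pair of odd integers is reached at time `n` from a pair of odd integers. -/
lemma exists_orbit_eq (h : Digits a g sp) (n : ℕ) {q : ℤ × ℤ} (hq1 : Odd q.1) (hq2 : Odd q.2) :
    ∃ p : ℤ × ℤ, Odd p.1 ∧ Odd p.2 ∧ orbit a g p n = q := by
  induction n generalizing q with
  | zero => exact ⟨q, hq1, hq2, rfl⟩
  | succ n ih =>
    obtain ⟨r, hr⟩ := hq1
    obtain ⟨s, hs⟩ := hq2
    obtain ⟨t, ht⟩ := h.even n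
    obtain ⟨p, hp1, hp2, hp⟩ := ih (q := (q.2 + a n * q.1 + g n, -q.1))
      ⟨s + a n * r + t, by rw [hr, hs]; linear_combination ht⟩ ⟨-r - 1, by rw [hr]; ring⟩
    refine ⟨p, hp1, hp2, ?_⟩
    rw [orbit, hp]
    ext
    · simp
    · simp only; ring

/-- A special digit gives a small product with large coefficients. -/
theorem exists_small_product (h : Digits a g sp) (hx : Expansion a g sp x d y e) {n : ℕ}
    (hn : sp n) :
    ∃ p : ℤ × ℤ, Odd p.1 ∧ Odd p.2 ∧ (2 : ℝ) ^ n ≤ |leftForm x d p 0| ∧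
      |leftForm x d p 0 * rightForm y e p 0| * (a n - x n - y (n + 1)) =
        (2 + leftCoef x d n) * rightCoef y e n := by
  -- The point `(1, -1)` after the special digit comes from `(3, -1)`, the equality case of
  -- `corner_after_special`.
  obtain ⟨p, hp1, hp2, hp⟩ := exists_orbit_eq h (n + 1) (q := (1, -1)) (by decide) (by decide)
  obtain ⟨hs1, hs2, ht1, ht2⟩ := coef_bounds h hx hn
  have hn1 : orbit a g p n = (3, -1) := by
    have h1 := congrArg Prod.fst hp
    have h2 := congrArg Prod.snd hp
    have h3 := (h.special n hn).2
    simp only [orbit] at h1 h2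
    have h4 : (orbit a g p n).2 = -1 := by omega
    rw [h4] at h2
    exact Prod.ext (by simp only; omega) h4
  have hX : leftForm x d (orbit a g p n) n = 2 + leftCoef x d n := by
    rw [hn1, leftForm, leftCoef]
    push_cast; ring
  have hY : rightForm y e (orbit a g p (n + 1)) (n + 1) = -rightCoef y e n := by
    rw [hp, rightForm, rightCoef]
    push_cast; ring
  refine ⟨p, hp1, hp2, ?_, ?_⟩
  · have h1 : ∀ m, |leftForm x d (orbit a g p m) m| * 2 ^ m ≤ |leftForm x d p 0| := by
      intro m
      induction m with
      | zero => simp [orbit]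
      | succ m ih =>
        rw [hx.left_succ, abs_mul]
        have h2 := hx.x_le (m + 1)
        have h3 : 0 ≤ |leftForm x d (orbit a g p m) m| * 2 ^ m := by positivity
        rw [pow_succ]
        nlinarith
    have h2 := h1 n
    rw [hX, abs_of_pos (by linarith)] at h2
    have h3 : (0 : ℝ) < 2 ^ n := by positivity
    nlinarith
  · rw [← abs_of_pos (hx.denom_pos h hn), ← abs_mul,
      (hx.toRecursion.product_eq hx.x_zero p n).2, hX, hY, abs_mul, abs_neg,
      abs_of_pos (by linarith : 0 < 2 + leftCoef x d n), abs_of_pos (by linarith)]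

end Bounds

/-! ### The exchange attached to an expansion -/

/-- The inhomogeneous term of the linear form of an expansion. -/
noncomputable def phase (y e : ℕ → ℝ) : ℝ := (1 - y 0 + e 0) / 2

/-- The inverse of the rotation length of the exchange of an expansion. -/
noncomputable def scale (y e : ℕ → ℝ) : ℝ := 2 - y 0 - phase y e

/-- The first length of the exchange of an expansion. -/
noncomputable def firstLength (y e : ℕ → ℝ) : ℝ := 1 - 1 / scale y e

/-- The second length of the exchange of an expansion. -/
noncomputable def secondLength (y e : ℕ → ℝ) : ℝ := phase y e / scale y e

section Parameters

variable {a g : ℕ → ℤ} {sp : ℕ → Prop} {x d y e : ℕ → ℝ}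

lemma phase_bounds (h : Digits a g sp) (hx : Expansion a g sp x d y e) :
    159 / 1000 ≤ -y 0 ∧ 49 / 100 ≤ phase y e ∧ phase y e ≤ 68 / 100 ∧ 148 / 100 ≤ scale y e ∧
      scale y e ≤ 169 / 100 := by
  have h1 := hx.y_eq 0
  have h2 := hx.e_eq 0
  rw [h.zero.1] at h1
  rw [h.zero.2] at h2
  push_cast at h1 h2
  have h3 : -y 0 * (6 - -y (0 + 1)) = 1 := by linarith
  obtain ⟨h4, h5⟩ := inv_six_bounds (by rw [abs_neg]; exact hx.y_le _) h3
  have h6 : |e 0| ≤ 175 / 1000 := by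
    rw [h2, zero_add, abs_mul]
    have h6 : |e (0 + 1)| ≤ 1 := by linarith [hx.e_lt (0 + 1), abs_nonneg (y (0 + 1))]
    have h7 : |y 0| ≤ 175 / 1000 := abs_le.2 ⟨by linarith, by linarith⟩
    nlinarith [abs_nonneg (y 0), abs_nonneg (e (0 + 1))]
  rw [abs_le] at h6
  unfold scale phase
  refine ⟨h4, ?_, ?_, ?_, ?_⟩ <;> linarith

/-- A zero of the right form would make the product vanish, against `homogeneous_bound`. -/
lemma form_ne_zero (hx : Expansion a g sp x d y e) (i j : ℤ) (hj : j ≠ 0) :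
    (i : ℝ) - j * y 0 ≠ 0 := by
  intro h0
  have h1 : rightForm y 0 (-j, i) 0 = 0 := by
    rw [← h0]; simp [rightForm]; ring
  rcases homogeneous_bound hx (p := (-j, i)) (by simpa using hj) with h2 | ⟨k, h2⟩
  · rw [h1, mul_zero, abs_zero] at h2
    norm_num at h2
  · rw [h1, mul_zero, abs_zero, zero_mul] at h2
    norm_num at h2

lemma form_ne_phase (h : Digits a g sp) (hx : Expansion a g sp x d y e) (i j : ℤ) :
    (i : ℝ) - j * y 0 ≠ phase y e := by
  intro h0
  refine right_ne_zero h hx (p := (1 - 2 * j, 2 * i - 1)) ⟨-j, by ring⟩ ⟨i - 1, by ring⟩ ?_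
  simp only [rightForm, phase] at h0 ⊢
  push_cast
  linarith

theorem admissible_expansion (h : Digits a g sp) (hx : Expansion a g sp x d y e) :
    Admissible (firstLength y e) (secondLength y e) ∧ firstLength y e < 1 / 2 ∧
      1 < 2 * firstLength y e + secondLength y e := by
  obtain ⟨h1, h2, h3, h4, h5⟩ := phase_bounds h hx
  have hr : 0 < scale y e := by linarith
  have hinv : scale y e * (1 / scale y e) = 1 := by field_simp
  have hsec : secondLength y e = phase y e * (1 / scale y e) := by
    rw [secondLength, mul_one_div]
  have hw : 0 < 1 / scale y e := by positivity
  have hs : scale y e = 2 - y 0 - phase y e := rfl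
  set w := 1 / scale y e with hwdef
  have hfirst : firstLength y e = 1 - w := rfl
  refine ⟨⟨?_, ?_, ?_, ?_⟩, ?_, ?_⟩
  · rw [hfirst]; nlinarith
  · rw [hsec]; exact mul_pos (by linarith) hw
  · rw [hfirst, hsec]; nlinarith
  · intro p q hpq
    -- Multiplied by `scale`, an i.d.o.c. relation says that an integer combination of `1` and `y 0`
    -- is zero (`t = 0`) or equals `phase` (`t = ±1`).
    have key : ∀ t : ℤ, (p : ℝ) * firstLength y e + q * secondLength y e = p - q + t →
        -(p : ℝ) = (t - q) * (2 - y 0) - t * phase y e := by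
      intro t ht
      rw [hfirst, hsec] at ht
      have h6 : scale y e * ((q : ℝ) * (phase y e * w) - p * w) = scale y e * (t - q) := by
        congr 1; linarith
      have h7 : (q : ℝ) * phase y e - p = scale y e * (t - q) := by
        rw [← h6]
        linear_combination ((p : ℝ) - q * phase y e) * hinv
      rw [hs] at h7
      linarith
    refine ⟨fun hh => ?_, fun hh => ?_, fun hh => ?_⟩
    · have h6 := key 0 (by push_cast; linarith)
      push_cast at h6
      have hq : q = 0 := by
        by_contra hq
        refine form_ne_zero hx (p - 2 * q) (-q) (neg_ne_zero.2 hq) ?_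
        push_cast
        linarith
      rw [hq] at h6
      have hp : p = 0 := by
        have : (p : ℝ) = 0 := by push_cast at h6; linarith
        exact_mod_cast this
      exact hpq (by rw [hp, hq])
    · have h6 := key 1 (by push_cast; linarith)
      refine form_ne_phase h hx (p + 2 - 2 * q) (1 - q) ?_
      push_cast at h6 ⊢
      linarith
    · have h6 := key (-1) (by push_cast; linarith)
      refine form_ne_phase h hx (-p + 2 + 2 * q) (1 + q) ?_
      push_cast at h6 ⊢
      linarith
  · rw [hfirst]; nlinarith
  -- The condition amounts to `y 0 < 0`, which the initial digit `-6` ensures.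
  · rw [hfirst, hsec]; nlinarith

/-- The parameters are such that `(1 + β) / (1 - α) = 2 - y 0` and `β / (1 - α) = phase`. Doubling
`l` and the form clears the halves, so that the point has odd coordinates; this is the source of the
factor `4`. -/
lemma inhomogeneous_form_eq (h : Digits a g sp) (hx : Expansion a g sp x d y e) (l N : ℤ) :
    |(l : ℝ)| * |N * (1 - firstLength y e) - l * (1 + secondLength y e) - secondLength y e| =
      |leftForm x d (1 + 2 * l, 2 * N - 4 * l - 1) 0 *
        rightForm y e (1 + 2 * l, 2 * N - 4 * l - 1) 0| / 4 * (1 - firstLength y e) := by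
  obtain ⟨h1, h2, h3, h4, h5⟩ := phase_bounds h hx
  have hr : 0 < scale y e := by linarith
  have hw : 0 < 1 - firstLength y e := by
    rw [firstLength, sub_sub_cancel]; positivity
  have hs : scale y e = 2 - y 0 - phase y e := rfl
  have e1 : leftForm x d (1 + 2 * l, 2 * N - 4 * l - 1) 0 = 2 * l := by
    simp only [leftForm, hx.x_zero, hx.d_zero]; push_cast; ring
  have e2 : N * (1 - firstLength y e) - l * (1 + secondLength y e) - secondLength y e =
      rightForm y e (1 + 2 * l, 2 * N - 4 * l - 1) 0 / 2 * (1 - firstLength y e) := by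
    have e3 : rightForm y e (1 + 2 * l, 2 * N - 4 * l - 1) 0 =
        2 * (N - l * (2 - y 0) - phase y e) := by
      simp only [rightForm, phase]; push_cast; ring
    rw [e3, firstLength, secondLength]
    field_simp
    rw [hs]
    ring
  rw [e1, e2, abs_mul, abs_mul, abs_mul, abs_div, abs_of_pos hw]
  norm_num
  ring

lemma homogeneous_form_eq (h : Digits a g sp) (hx : Expansion a g sp x d y e) (l N : ℤ) :
    |(l : ℝ)| * |N * (1 - firstLength y e) - l * (1 + secondLength y e)| =
      |leftForm x 0 (l, N - 2 * l) 0 * rightForm y 0 (l, N - 2 * l) 0| *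
        (1 - firstLength y e) := by
  obtain ⟨h1, h2, h3, h4, h5⟩ := phase_bounds h hx
  have hr : 0 < scale y e := by linarith
  have hw : 0 < 1 - firstLength y e := by
    rw [firstLength, sub_sub_cancel]; positivity
  have hs : scale y e = 2 - y 0 - phase y e := rfl
  have e1 : leftForm x 0 (l, N - 2 * l) 0 = l := by
    simp [leftForm, hx.x_zero]
  have e2 : N * (1 - firstLength y e) - l * (1 + secondLength y e) =
      rightForm y 0 (l, N - 2 * l) 0 * (1 - firstLength y e) := by
    simp only [rightForm, Pi.zero_apply]
    rw [firstLength, secondLength]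
    field_simp
    rw [hs]
    push_cast
    ring
  rw [e1, e2, abs_mul, abs_mul, abs_of_pos hw]
  ring

theorem upperB_expansion_le (h : Digits a g sp) (hx : Expansion a g sp x d y e) {B : ℝ}
    (hB : 4 ≤ 27 / 100 * B) (hA : ∀ n, sp n → a n + 1 ≤ B) {N₀ : ℕ}
    (hsp : ∀ n ≥ N₀, sp n → 4 * (a n - x n - y (n + 1)) ≤
      B * ((2 + leftCoef x d n) * rightCoef y e n)) :
    upperB (exchangeLanguage (firstLength y e) (secondLength y e))
      (codingMeasure (firstLength y e) (secondLength y e)) ≤ ENNReal.ofReal B := by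
  obtain ⟨hadm, -, -⟩ := admissible_expansion h hx
  have hB0 : 0 < B := by linarith
  have hw : 0 < 1 - firstLength y e := by linarith [hadm.sum_lt, hadm.mid_pos]
  obtain ⟨K, hK⟩ := exists_large h hx N₀
  obtain ⟨K', hK'⟩ := exists_nat_ge K
  refine upperB_le hadm hB0 (K' + 1) fun l hl N => ⟨?_, ?_⟩
  · have hl0 : l ≠ 0 := by
      rintro rfl
      rw [abs_zero] at hl
      omega
    rw [mul_assoc, homogeneous_form_eq h hx, ← mul_assoc]
    refine le_mul_of_one_le_left hw.le ?_
    rcases homogeneous_bound hx (p := (l, N - 2 * l)) hl0 with h1 | ⟨k, h1⟩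
    · nlinarith
    · have h2 : |a k - x k - y (k + 1)| ≤ B := by
        by_cases hk : sp k
        · rw [abs_of_pos (hx.denom_pos h hk)]
          linarith [abs_le.1 (hx.x_le k), abs_le.1 (hx.y_le (k + 1)), hA k hk]
        · linarith [hx.denom_abs_le k, digit_abs_le h hk]
      refine h1.trans ?_
      rw [mul_comm B]
      gcongr
  · rw [mul_assoc, inhomogeneous_form_eq h hx, ← mul_assoc]
    refine le_mul_of_one_le_left hw.le ?_
    set p : ℤ × ℤ := (1 + 2 * l, 2 * N - 4 * l - 1)
    have hp1 : Odd p.1 := ⟨l, by simp only [p]; ring⟩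
    have hp2 : Odd p.2 := ⟨N - 2 * l - 1, by simp only [p]; ring⟩
    have hlarge : K ≤ |leftForm x d p 0| := by
      have e1 : leftForm x d p 0 = 2 * l := by
        simp only [leftForm, hx.x_zero, hx.d_zero, p]; push_cast; ring
      rw [e1, abs_mul, abs_two]
      have : ((K' + 1 : ℕ) : ℝ) ≤ |(l : ℝ)| := by exact_mod_cast hl
      push_cast at this
      linarith [(Nat.cast_nonneg K' : (0 : ℝ) ≤ K')]
    obtain ⟨m, hm, hm'⟩ := exists_level a g p
    -- A bounded level with a large `l` gives a large product, so only special digits beyond `N₀`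
    -- matter.
    rcases le_or_gt m N₀ with hmN | hmN
    · have := hK p hp1 hp2 hlarge m hmN hm
      nlinarith
    · obtain ⟨k, rfl⟩ : ∃ k, m = k + 1 := ⟨m - 1, by omega⟩
      rcases inhomogeneous_bound h hx hp1 hp2 (hm' k rfl) hm with h1 | ⟨n, hkn, hn, h1⟩
      · nlinarith
      · have h2 := hsp n (by omega) hn
        have h3 := hx.denom_pos h hn
        have h4 := mul_le_mul_of_nonneg_left h1 hB0.le
        have h5 : (a n - x n - y (n + 1)) * 4 ≤ (a n - x n - y (n + 1)) *
          (B * |leftForm x d p 0 * rightForm y e p 0|) := by linarith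
        have := le_of_mul_le_mul_left h5 h3
        linarith

theorem le_upperB_expansion (h : Digits a g sp) (hx : Expansion a g sp x d y e) {B : ℝ}
    (hB : 0 < B) (hsp : ∀ N₀ : ℕ, ∃ n ≥ N₀, sp n ∧
      B * ((2 + leftCoef x d n) * rightCoef y e n) ≤ 4 * (a n - x n - y (n + 1))) :
    ENNReal.ofReal B ≤ upperB (exchangeLanguage (firstLength y e) (secondLength y e))
      (codingMeasure (firstLength y e) (secondLength y e)) := by
  obtain ⟨hadm, -, -⟩ := admissible_expansion h hx
  have hw : 0 < 1 - firstLength y e := by linarith [hadm.sum_lt, hadm.mid_pos]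
  refine le_upperB hadm hB fun K => ?_
  obtain ⟨n, hnK, hn, hle⟩ := hsp (K + 1)
  obtain ⟨⟨p1, p2⟩, ⟨l, hl⟩, ⟨r, hr⟩, hlarge, hQ⟩ := exists_small_product h hx hn
  simp only at hl hr
  have hp : (p1, p2) = (1 + 2 * l, 2 * (r + 1 + 2 * l) - 4 * l - 1) := by
    ext
    · simp only; omega
    · simp only; omega
  rw [hp] at hlarge hQ
  refine ⟨l, ?_, r + 1 + 2 * l, ?_⟩
  · have e1 : leftForm x d (1 + 2 * l, 2 * (r + 1 + 2 * l) - 4 * l - 1) 0 = 2 * l := by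
      simp only [leftForm, hx.x_zero, hx.d_zero]; push_cast; ring
    rw [e1, abs_mul, abs_two] at hlarge
    have h1 : n < 2 ^ n := Nat.lt_two_pow_self
    obtain ⟨m, rfl⟩ : ∃ m, n = m + 1 := ⟨n - 1, by omega⟩
    have h2 : m < 2 ^ m := Nat.lt_two_pow_self
    have h3 : ((K : ℕ) : ℝ) ≤ 2 ^ m := by exact_mod_cast (by omega : K ≤ 2 ^ m)
    rw [pow_succ] at hlarge
    have h4 : (K : ℝ) ≤ |(l : ℝ)| := by linarith
    exact_mod_cast h4
  · rw [mul_assoc, inhomogeneous_form_eq h hx, ← mul_assoc]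
    refine mul_le_of_le_one_left hw.le ?_
    have h3 := hx.denom_pos h hn
    rw [← hQ] at hle
    have h5 : (a n - x n - y (n + 1)) * (B * |leftForm x d
        (1 + 2 * l, 2 * (r + 1 + 2 * l) - 4 * l - 1) 0 * rightForm y e
        (1 + 2 * l, 2 * (r + 1 + 2 * l) - 4 * l - 1) 0|) ≤ (a n - x n - y (n + 1)) * 4 := by
      linarith
    have := le_of_mul_le_mul_left h5 h3
    linarith

/-- A value of `limsup 1 / (n e_n)` at the exchange of an expansion is in the spectrum. -/
theorem mem_spectrum_of_expansion (h : Digits a g sp) (hx : Expansion a g sp x d y e) {b : ℝ≥0∞}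
    (hb : upperB (exchangeLanguage (firstLength y e) (secondLength y e))
      (codingMeasure (firstLength y e) (secondLength y e)) = b) :
    b ∈ upperBLSpectrum restrictedThreeIntervalExchanges := by
  obtain ⟨hadm, h1, h2⟩ := admissible_expansion h hx
  exact ⟨_, ⟨_, _, hadm.left_pos, hadm.mid_pos, hadm.sum_lt, hadm.idoc, h1, h2, rfl⟩, _,
    isUniqueInvariantProbability_codingMeasure hadm, hb⟩

end Parameters

/-! ### Digits in blocks -/

/-- The number of the block which contains a position. -/
def blockIndex (n : ℕ) : ℕ := Nat.sqrt (n + 1)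

/-- The place of a position in its block. -/
def blockPos (n : ℕ) : ℕ := n + 1 - blockIndex n * blockIndex n

/-- The digit in the middle of each block is special. -/
def IsMiddle (n : ℕ) : Prop := blockPos n = blockIndex n

/-- The `j`-th block: `j` digits `(-6, 0)`, the digit `(A, 4 - A)`, the first `j` digits of `W`. -/
def blockDigit (A : ℕ → ℤ) (W : ℕ → ℤ × ℤ) (n : ℕ) : ℤ × ℤ :=
  if blockPos n < blockIndex n then (-6, 0)
  else if blockPos n = blockIndex n then (A (blockIndex n), 4 - A (blockIndex n))
  else W (blockPos n - blockIndex n - 1)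

lemma block_eq {n j i : ℕ} (hi : i ≤ 2 * j) (hn : n + 1 = j * j + i) :
    blockIndex n = j ∧ blockPos n = i := by
  have h1 : blockIndex n = j := by rw [blockIndex, hn, Nat.sqrt_add_eq _ (by omega)]
  exact ⟨h1, by rw [blockPos, h1, hn]; omega⟩

lemma block_spec (n : ℕ) : 1 ≤ blockIndex n ∧ blockPos n ≤ 2 * blockIndex n ∧
    n + 1 = blockIndex n * blockIndex n + blockPos n := by
  have h1 : blockIndex n * blockIndex n ≤ n + 1 := Nat.sqrt_le _
  have h2 : n + 1 ≤ blockIndex n * blockIndex n + blockIndex n + blockIndex n := Nat.sqrt_le_add _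
  have h3 : 1 ≤ blockIndex n := Nat.le_sqrt.2 (by omega)
  unfold blockPos
  omega

lemma isMiddle_spec {n : ℕ} (h : IsMiddle n) :
    n + 1 = blockIndex n * blockIndex n + blockIndex n := by
  have h1 := (block_spec n).2.2
  rwa [h] at h1

lemma exists_isMiddle {j : ℕ} (hj : 1 ≤ j) : ∃ n, IsMiddle n ∧ blockIndex n = j ∧ j ≤ n := by
  have h1 : j ≤ j * j := Nat.le_mul_self j
  obtain ⟨h2, h3⟩ := block_eq (n := j * j + j - 1) (j := j) (i := j) (by omega) (by omega)
  exact ⟨_, h3.trans h2.symm, h2, by omega⟩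

section Blocks

variable {A : ℕ → ℤ} {W : ℕ → ℤ × ℤ}

lemma blockDigit_filler {n j i : ℕ} (hi : i < j) (hn : n + 1 = j * j + i) :
    blockDigit A W n = (-6, 0) := by
  obtain ⟨h1, h2⟩ := block_eq (by omega) hn
  rw [blockDigit, h1, h2, if_pos hi]

lemma blockDigit_middle {n : ℕ} (h : IsMiddle n) :
    blockDigit A W n = (A (blockIndex n), 4 - A (blockIndex n)) := by
  rw [blockDigit, if_neg (by rw [h]; omega)]
  exact if_pos h

lemma blockDigit_word {n j i : ℕ} (hi : i < j) (hn : n + 1 = j * j + (j + 1 + i)) :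
    blockDigit A W n = W i := by
  obtain ⟨h1, h2⟩ := block_eq (by omega) hn
  rw [blockDigit, h1, h2, if_neg (by omega), if_neg (by omega)]
  congr 1
  omega

theorem digits_block (hA : ∀ j, 9 ≤ A j) (hW : W 0 = (6, 0))
    (hW' : ∀ k, NormalDigit (W k).1 (W k).2 ∧ Even ((W k).1 + (W k).2)) :
    Digits (fun n => (blockDigit A W n).1) (fun n => (blockDigit A W n).2) IsMiddle where
  even n := by
    simp only [blockDigit]
    split_ifs
    · decide
    · exact ⟨2, by ring⟩
    · exact (hW' _).2
  normal n hn := by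
    unfold IsMiddle at hn
    simp only [blockDigit, if_neg hn]
    split_ifs
    · exact ⟨by decide, by decide, by decide⟩
    · exact (hW' _).1
  special n hn := by
    simp [blockDigit_middle hn, hA]
  zero := by
    simp [blockDigit_filler (A := A) (W := W) (n := 0) (j := 1) (i := 0) one_pos rfl]
  before n hn := by
    have h1 := isMiddle_spec hn
    have h2 := (block_spec (n + 1)).1
    simp [blockDigit_filler (A := A) (W := W) (n := n) (j := blockIndex (n + 1))
      (i := blockIndex (n + 1) - 1) (by omega) (by omega)]
  after n hn := by
    have h1 := isMiddle_spec hn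
    have h2 := (block_spec n).1
    simp [blockDigit_word (A := A) (W := W) (n := n + 1) (j := blockIndex n)
      (i := 0) (by omega) (by omega), hW]
  gap n hn := by
    have h1 := isMiddle_spec hn
    have h2 := (block_spec n).1
    intro h3
    -- In the block `j = 1` the position `n + 2` already begins the next block.
    rcases h2.eq_or_lt with h4 | h4
    · rw [← h4] at h1
      obtain ⟨h5, h6⟩ := block_eq (n := n + 2) (j := 2) (i := 0) (by omega) (by omega)
      rw [IsMiddle, h5, h6] at h3
      omega
    · obtain ⟨h5, h6⟩ := block_eq (n := n + 2) (j := blockIndex n) (i := blockIndex n + 2)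
        (by omega) (by omega)
      rw [IsMiddle, h5, h6] at h3
      omega

end Blocks

lemma normalDigit_six : NormalDigit 6 0 ∧ Even ((6 : ℤ) + 0) :=
  ⟨⟨by decide, by decide, by decide⟩, by decide⟩

/-! ### The infinite value -/

theorem top_mem_spectrum : ⊤ ∈ upperBLSpectrum restrictedThreeIntervalExchanges := by
  have h := digits_block (A := fun j => (j : ℤ) + 10) (W := fun _ => (6, 0))
    (fun j => by omega) rfl (fun _ => normalDigit_six)
  obtain ⟨x, d, y, e, hx⟩ := exists_expansion h
  refine mem_spectrum_of_expansion h hx (ENNReal.eq_top_of_forall_nnreal_le fun r => ?_)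
  have h1 := le_upperB_expansion h hx (B := r + 1) (by positivity) fun N₀ => by
    obtain ⟨K, hK⟩ := exists_nat_ge ((r : ℝ) + 1)
    obtain ⟨n, hn, hj, hjn⟩ := exists_isMiddle (j := N₀ + K + 1) (by omega)
    refine ⟨n, by omega, hn, ?_⟩
    obtain ⟨h1, h2, h3, h4⟩ := coef_bounds h hx hn
    have h5 : (2 + leftCoef x d n) * rightCoef y e n ≤ 4 := by nlinarith
    have h6 := abs_le.1 (hx.x_le n)
    have h7 := abs_le.1 (hx.y_le (n + 1))
    have h8 : (r + 1 : ℝ) * ((2 + leftCoef x d n) * rightCoef y e n) ≤ (r + 1) * 4 := by gcongr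
    simp only [blockDigit_middle hn, hj]
    push_cast
    have : (0 : ℝ) ≤ N₀ := Nat.cast_nonneg _
    linarith
  refine le_trans ?_ h1
  rw [← ENNReal.ofReal_coe_nnreal]
  exact ENNReal.ofReal_le_ofReal (by linarith)

/-! ### Words which fit a prescribed linear relation -/

/-- Each of the six digits handles a strip of the `(r, k)` plane, and these strips cover the square
of side `28/100`. -/
lemma cover_nonneg {r k : ℝ} (hr : 0 ≤ r) (hr' : r ≤ 28 / 100) (hk : 0 ≤ k) (hk' : k ≤ 28 / 100) :
    ∃ a g s : ℤ, NormalDigit a g ∧ Even (a + g) ∧ (s = 1 ∨ s = -1) ∧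
      |a * r + s * k - g| ≤ 28 / 100 := by
  by_contra! hne
  have h1 := hne 4 0 (-1) ⟨by decide, by decide, by decide⟩ (by decide) (by decide)
  have h2 := hne 11 1 1 ⟨by decide, by decide, by decide⟩ (by decide) (by decide)
  have h3 := hne 7 1 1 ⟨by decide, by decide, by decide⟩ (by decide) (by decide)
  have h4 := hne 7 1 (-1) ⟨by decide, by decide, by decide⟩ (by decide) (by decide)
  have h5 := hne 10 2 (-1) ⟨by decide, by decide, by decide⟩ (by decide) (by decide)
  have h6 := hne 8 2 (-1) ⟨by decide, by decide, by decide⟩ (by decide) (by decide)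
  push_cast at h1 h2 h3 h4 h5 h6
  rw [lt_abs] at h1 h2 h3 h4 h5 h6
  rcases h1 with h1 | h1
  swap; · linarith
  rcases h6 with h6 | h6
  · linarith
  rcases h2 with h2 | h2
  swap; · linarith
  rcases h3 with h3 | h3
  swap; · linarith
  rcases h4 with h4 | h4
  swap; · linarith
  rcases h5 with h5 | h5 <;> linarith

/-- Normality and parity of digits are invariant under sign changes, which reduces to
`cover_nonneg`. Outside the square `(6, 0)` is a default value, making the choice of digits a total
function. -/
lemma cover (r k : ℝ) : ∃ a g : ℤ, NormalDigit a g ∧ Even (a + g) ∧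
    (|r| ≤ 28 / 100 → |k| ≤ 28 / 100 → |a * r - k - g| ≤ 28 / 100) := by
  by_cases hr : |r| ≤ 28 / 100
  swap
  · exact ⟨6, 0, ⟨by decide, by decide, by decide⟩, by decide, fun h => absurd h hr⟩
  by_cases hk : |k| ≤ 28 / 100
  swap
  · exact ⟨6, 0, ⟨by decide, by decide, by decide⟩, by decide, fun _ h => absurd h hk⟩
  obtain ⟨a, g, s, hN, heven, hs, hle⟩ := cover_nonneg (abs_nonneg r) hr (abs_nonneg k) hk
  obtain ⟨σ, hσ, hσr⟩ : ∃ σ : ℤ, (σ = 1 ∨ σ = -1) ∧ |r| = σ * r := by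
    rcases abs_choice r with h | h
    · exact ⟨1, Or.inl rfl, by rw [h]; simp⟩
    · exact ⟨-1, Or.inr rfl, by rw [h]; simp⟩
  obtain ⟨τ, hτ, hτk⟩ : ∃ τ : ℤ, (τ = 1 ∨ τ = -1) ∧ s * |k| = -(τ * k) := by
    rcases abs_choice k with h | h <;> rcases hs with rfl | rfl
    · exact ⟨-1, Or.inr rfl, by rw [h]; simp⟩
    · exact ⟨1, Or.inl rfl, by rw [h]; simp⟩
    · exact ⟨1, Or.inl rfl, by rw [h]; simp⟩
    · exact ⟨-1, Or.inr rfl, by rw [h]; simp⟩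
  refine ⟨τ * σ * a, τ * g, ?_, ?_, fun _ _ => ?_⟩
  · have h1 : |τ| = 1 := by rcases hτ with rfl | rfl <;> rfl
    have h2 : |σ| = 1 := by rcases hσ with rfl | rfl <;> rfl
    simpa only [NormalDigit, abs_mul, h1, h2, one_mul] using hN
  · rcases hτ with rfl | rfl <;> rcases hσ with rfl | rfl <;>
      simpa [Int.even_add] using heven
  · rw [hσr, hτk] at hle
    have h1 : |(τ : ℝ)| = 1 := by rcases hτ with rfl | rfl <;> simp
    have h2 : (τ : ℝ) * τ = 1 := by rcases hτ with rfl | rfl <;> simp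
    have h3 : ((τ * σ * a : ℤ) : ℝ) * r - k - (τ * g : ℤ) = τ * (a * (σ * r) + -(τ * k) - g) := by
      push_cast
      linear_combination k * h2
    rw [h3, abs_mul, h1, one_mul]
    exact hle

/-- The numbers `r k` are the coefficients of the relation `e + κ y = r₀` after `k` digits. Greedy
choices from `cover` keep them bounded, which is all that `right_contraction` needs. -/
lemma exists_word {r₀ κ : ℝ} (h0 : |r₀| ≤ 28 / 100) (h1 : |6 * r₀ - κ| ≤ 28 / 100) :
    ∃ (W : ℕ → ℤ × ℤ) (r : ℕ → ℝ), W 0 = (6, 0) ∧ r 0 = r₀ ∧ r 1 = 6 * r₀ - κ ∧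
      (∀ k, r (k + 2) = (W (k + 1)).1 * r (k + 1) - r k - (W (k + 1)).2) ∧
      (∀ k, |r k| ≤ 28 / 100) ∧ ∀ k, NormalDigit (W k).1 (W k).2 ∧ Even ((W k).1 + (W k).2) := by
  choose a g hN heven hle using cover
  let st : ℕ → ℝ × ℝ := fun k => Nat.rec (motive := fun _ => ℝ × ℝ) (6 * r₀ - κ, r₀)
    (fun _ p => (a p.1 p.2 * p.1 - p.2 - g p.1 p.2, p.1)) k
  have hst : ∀ k, st (k + 1) = (a (st k).1 (st k).2 * (st k).1 - (st k).2 -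
    g (st k).1 (st k).2, (st k).1) := fun k => rfl
  have hbd : ∀ k, |(st k).1| ≤ 28 / 100 ∧ |(st k).2| ≤ 28 / 100 := by
    intro k
    induction k with
    | zero => exact ⟨h1, h0⟩
    | succ k ih =>
      rw [hst]
      exact ⟨hle _ _ ih.1 ih.2, ih.1⟩
  refine ⟨fun k => Nat.casesOn k (6, 0) fun k => (a (st k).1 (st k).2, g (st k).1 (st k).2),
    fun k => (st k).2, rfl, rfl, rfl, fun k => ?_, fun k => (hbd k).2, fun k => ?_⟩
  · simp only [hst]
  · rcases k with _ | k
    · exact normalDigit_six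
    · exact ⟨hN _ _, heven _ _⟩

/-! ### The finite values -/

section Finite

variable {a g : ℕ → ℤ} {sp : ℕ → Prop} {x d y e : ℕ → ℝ}

lemma left_contraction (hx : Expansion a g sp x d y e) {m k : ℕ} {c : ℝ} (hc : c * (-6 - c) = 1)
    (hc' : |c| ≤ 1 / 5) (h6 : ∀ i < k, a (m + i) = -6 ∧ g (m + i) = 0) :
    |x (m + k) - c| ≤ (27 / 100) ^ k ∧ |d (m + k)| ≤ (27 / 100) ^ k := by
  induction k with
  | zero =>
    have h1 := hx.x_le m
    have h2 := hx.d_le m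
    have h3 := abs_sub (x m) c
    rw [pow_zero, add_zero]
    exact ⟨by linarith, by linarith [abs_nonneg (x m)]⟩
  | succ k ih =>
    obtain ⟨ih1, ih2⟩ := ih fun i hi => h6 i (by omega)
    obtain ⟨ha, hg⟩ := h6 k (by omega)
    have h1 := hx.x_succ (m + k)
    have h2 := hx.d_succ (m + k)
    rw [ha] at h1
    rw [hg] at h2
    push_cast at h1 h2
    have h3 : x (m + (k + 1)) - c = x (m + k + 1) * (c * (x (m + k) - c)) := by
      rw [← add_assoc]
      linear_combination c * h1 - x (m + k + 1) * hc
    have h4 : |c * (x (m + k) - c)| ≤ (27 / 100) ^ k := by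
      rw [abs_mul]
      have := mul_le_mul (hc'.trans (by norm_num : (1 / 5 : ℝ) ≤ 1)) ih1 (abs_nonneg _) zero_le_one
      linarith
    rw [h3, ← add_assoc, h2, zero_add, abs_mul (x (m + k + 1)), abs_mul (x (m + k + 1)), pow_succ, mul_comm _ (27 / 100 : ℝ)]
    have h5 := hx.x_le (m + k + 1)
    exact ⟨mul_le_mul h5 h4 (abs_nonneg _) (by norm_num),
      mul_le_mul h5 ih2 (abs_nonneg _) (by norm_num)⟩

/-- The defect `e + r i * y - r (i + 1)` of the transported relation is multiplied by `y` when a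
digit is read backwards, so after `k` digits the initial defect is at most `0.27 ^ k` times a
bounded one. -/
lemma right_contraction (hx : Expansion a g sp x d y e) {W : ℕ → ℤ × ℤ} {r : ℕ → ℝ} {κ : ℝ}
    {m k : ℕ} (hk : 1 ≤ k) (hW : W 0 = (6, 0)) (hr1 : r 1 = 6 * r 0 - κ)
    (hr : ∀ k, r (k + 2) = (W (k + 1)).1 * r (k + 1) - r k - (W (k + 1)).2)
    (hrle : ∀ k, |r k| ≤ 28 / 100) (hdig : ∀ i < k, a (m + i) = (W i).1 ∧ g (m + i) = (W i).2) :
    |e m + κ * y m - r 0| ≤ 2 * (27 / 100) ^ k := by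
  have h1 : e m + κ * y m - r 0 = y m * (e (m + 1) + r 0 * y (m + 1) - r 1) := by
    obtain ⟨ha, hg⟩ := hdig 0 (by omega)
    have h2 := hx.y_eq m
    have h3 := hx.e_eq m
    rw [add_zero, hW] at ha hg
    rw [ha] at h2
    rw [hg] at h3
    push_cast at h2 h3
    rw [h3, hr1]
    linear_combination r 0 * h2
  have h2 : ∀ i, i + 1 ≤ k → |e m + κ * y m - r 0| ≤
      (27 / 100) ^ (i + 1) * |e (m + (i + 1)) + r i * y (m + (i + 1)) - r (i + 1)| := by
    intro i
    induction i with
    | zero =>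
      intro _
      rw [h1, abs_mul, zero_add, pow_one]
      exact mul_le_mul_of_nonneg_right (hx.y_le m) (abs_nonneg _)
    | succ i ih =>
      intro hi
      refine (ih (by omega)).trans ?_
      obtain ⟨ha, hg⟩ := hdig (i + 1) (by omega)
      have h2 := hx.y_eq (m + (i + 1))
      have h3 := hx.e_eq (m + (i + 1))
      rw [ha] at h2
      rw [hg] at h3
      have h4 : e (m + (i + 1)) + r i * y (m + (i + 1)) - r (i + 1) =
          y (m + (i + 1)) * (e (m + (i + 1 + 1)) + r (i + 1) * y (m + (i + 1 + 1)) -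
            r (i + 1 + 1)) := by
        rw [h3, hr i, ← add_assoc m (i + 1) 1]
        linear_combination r (i + 1) * h2
      rw [h4, abs_mul, pow_succ _ (i + 1), mul_assoc]
      gcongr
      exact hx.y_le _
  obtain ⟨i, rfl⟩ : ∃ i, k = i + 1 := ⟨k - 1, by omega⟩
  refine (h2 i le_rfl).trans ?_
  rw [mul_comm]
  gcongr
  have h3 := abs_sub (e (m + (i + 1)) + r i * y (m + (i + 1))) (r (i + 1))
  have h4 := abs_add_le (e (m + (i + 1))) (r i * y (m + (i + 1)))
  rw [abs_mul] at h4
  have h5 := mul_le_mul (hrle i) (hx.y_le (m + (i + 1))) (abs_nonneg _) (by norm_num)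
  have h6 := hrle (i + 1)
  have h7 := hx.e_lt (m + (i + 1))
  have h8 := abs_nonneg (y (m + (i + 1)))
  linarith

/-- The value of `limsup 1 / (n e_n)` when the products at the special digits converge. -/
theorem upperB_expansion_eq (h : Digits a g sp) (hx : Expansion a g sp x d y e) {b : ℝ}
    (hb : 4 ≤ 27 / 100 * b) (ha : ∀ n, sp n → a n + 1 ≤ b) (hinf : ∀ N₀ : ℕ, ∃ n ≥ N₀, sp n)
    (hlim : ∀ η : ℝ, 0 < η → ∃ N₀ : ℕ, ∀ n ≥ N₀, sp n →
      |b * ((2 + leftCoef x d n) * rightCoef y e n) - 4 * (a n - x n - y (n + 1))| ≤ η) :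
    upperB (exchangeLanguage (firstLength y e) (secondLength y e))
      (codingMeasure (firstLength y e) (secondLength y e)) = ENNReal.ofReal b := by
  have hcoef : ∀ n, sp n → 1 ≤ (2 + leftCoef x d n) * rightCoef y e n := by
    intro n hn
    obtain ⟨hs1, hs2, ht1, ht2⟩ := coef_bounds h hx hn
    nlinarith
  refine le_antisymm ?_ ?_
  · refine ENNReal.le_of_forall_pos_le_add fun η hη _ => ?_
    have hη' : (0 : ℝ) < η := hη
    rw [← ENNReal.ofReal_coe_nnreal, ← ENNReal.ofReal_add (by linarith) hη'.le]
    obtain ⟨N₀, hN₀⟩ := hlim η hη'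
    refine upperB_expansion_le h hx (N₀ := N₀) (by linarith)
      (fun n hn => by linarith [ha n hn]) fun n hnN hn => ?_
    have h1 := (abs_le.1 (hN₀ n hnN hn)).1
    have h2 := mul_le_mul_of_nonneg_left (hcoef n hn) hη'.le
    linarith
  · refine ENNReal.le_of_forall_pos_le_add fun η hη _ => ?_
    have hη' : (0 : ℝ) < η := hη
    rw [← ENNReal.ofReal_coe_nnreal (p := η)]
    rcases le_or_gt b η with hbη | hbη
    · exact (ENNReal.ofReal_le_ofReal hbη).trans le_add_self
    rw [← sub_add_cancel b (η : ℝ), ENNReal.ofReal_add (by linarith) hη'.le]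
    refine add_le_add_left ?_ _
    refine le_upperB_expansion h hx (by linarith) fun N₁ => ?_
    obtain ⟨N₀, hN₀⟩ := hlim η hη'
    obtain ⟨n, hnN, hn⟩ := hinf (N₀ + N₁)
    refine ⟨n, by omega, hn, ?_⟩
    have h1 := (abs_le.1 (hN₀ n (by omega) hn)).2
    have h2 := mul_le_mul_of_nonneg_left (hcoef n hn) hη'.le
    linarith

end Finite

lemma sqrt_two_bounds : √2 * √2 = 2 ∧ 1414 / 1000 ≤ √2 ∧ √2 ≤ 1415 / 1000 :=
  ⟨Real.mul_self_sqrt (by norm_num), Real.le_sqrt_of_sq_le (by norm_num),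
    Real.sqrt_le_iff.2 ⟨by norm_num, by norm_num⟩⟩

theorem ofReal_mem_spectrum {b : ℝ} (hb : 12 + 2 * √2 ≤ b) :
    ENNReal.ofReal b ∈ upperBLSpectrum restrictedThreeIntervalExchanges := by
  obtain ⟨hs, hs1, hs2⟩ := sqrt_two_bounds
  set c : ℝ := -3 + 2 * √2 with hc
  set E : ℝ := b * (6 - 2 * √2) with hE
  have hcc : c * (-6 - c) = 1 := by rw [hc]; linear_combination (-4) * hs
  have hc' : |c| ≤ 1 / 5 := abs_le.2 ⟨by linarith, by linarith⟩
  have hE1 : 47 ≤ E := by nlinarith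
  have hE2 : E ≤ 3172 / 1000 * b := by nlinarith
  -- The condition `|6 r₀ - κ| ≤ 28/100` places `24 (z - c) - 4` between `4.72 E` and `5.28 E`. The
  -- window for `z` has length `0.56 E / 24 > 1` since `E ≥ 47`, which is where the threshold on `b`
  -- enters; `z` is its least integer.
  set z : ℤ := ⌈(472 / 100 * E + 4) / 24 + c⌉ with hz
  have hz1 : (472 / 100 * E + 4) / 24 + c ≤ z := Int.le_ceil _
  have hz2 : (z : ℝ) < (472 / 100 * E + 4) / 24 + c + 1 := Int.ceil_lt_add_one _
  have hz9 : 9 ≤ z := by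
    have : (8 : ℝ) < z := by linarith
    have : 8 < z := by exact_mod_cast this
    omega
  set κ : ℝ := 4 / E - 1 with hκ
  set r₀ : ℝ := 4 * (z - c) / E - 1 with hr₀
  have hEκ : E * κ = 4 - E := by rw [hκ]; field_simp
  have hEr : E * r₀ = 4 * (z - c) - E := by rw [hr₀]; field_simp
  have hr1 : |6 * r₀ - κ| ≤ 28 / 100 := by
    rw [abs_le]
    constructor
    · refine le_of_mul_le_mul_left (a := E) ?_ (by linarith)
      linarith
    · refine le_of_mul_le_mul_left (a := E) ?_ (by linarith)
      linarith
  have hr0 : |r₀| ≤ 28 / 100 := by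
    rw [abs_le]
    constructor
    · refine le_of_mul_le_mul_left (a := E) ?_ (by linarith)
      linarith
    · refine le_of_mul_le_mul_left (a := E) ?_ (by linarith)
      linarith
  obtain ⟨W, r, hW0, hrr0, hrr1, hrec, hrle, hWN⟩ := exists_word hr0 hr1
  have h := digits_block (A := fun _ => z) (fun _ => hz9) hW0 hWN
  obtain ⟨x, d, y, e, hx⟩ := exists_expansion h
  have hest : ∀ n, IsMiddle n → |b * ((2 + leftCoef x d n) * rightCoef y e n) -
      4 * (z - x n - y (n + 1))| ≤ (27 / 100) ^ blockIndex n * (2 * E + 2 * b + 4) := by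
    intro n hn
    set j := blockIndex n with hj
    have hn1 : n + 1 = j * j + j := isMiddle_spec hn
    have hj1 : 1 ≤ j := (block_spec n).1
    have hjj : 1 ≤ j * j := Nat.mul_pos hj1 hj1
    have hleft := left_contraction hx (m := j * j - 1) (k := j) hcc hc' fun i hi => by
      simp [blockDigit_filler (A := fun _ => z) (W := W) (n := j * j - 1 + i) hi (by omega)]
    rw [show j * j - 1 + j = n by omega] at hleft
    have hright := right_contraction hx (m := n + 1) (k := j) (κ := κ) hj1 hW0
      (by rw [hrr0]; exact hrr1) hrec hrle fun i hi => by
        simp [blockDigit_word (A := fun _ => z) (W := W) (n := n + 1 + i) hi (by omega)]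
    rw [hrr0] at hright
    obtain ⟨-, -, ht1, ht2⟩ := coef_bounds h hx hn
    -- The deviation from the prescribed value is split into the defect of the right relation,
    -- weighted by `E`, and the deviations of `x n` from `c` and of `d n` from `0`.
    have hkey : b * ((2 + leftCoef x d n) * rightCoef y e n) - 4 * (z - x n - y (n + 1)) =
        E * (e (n + 1) + κ * y (n + 1) - r₀) + b * ((d n - (x n - c)) * rightCoef y e n) +
          4 * (x n - c) := by
      simp only [leftCoef, rightCoef]
      rw [hE] at hEκ hEr ⊢
      rw [hc] at hEr ⊢
      linear_combination hEr - y (n + 1) * hEκ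
    rw [hkey]
    have h1 : |E * (e (n + 1) + κ * y (n + 1) - r₀)| ≤ E * (2 * (27 / 100) ^ j) := by
      rw [abs_mul, abs_of_pos (by linarith : 0 < E)]
      gcongr
    have h2 : |b * ((d n - (x n - c)) * rightCoef y e n)| ≤ b * (2 * (27 / 100) ^ j * 1) := by
      rw [abs_mul, abs_mul, abs_of_pos (by linarith : 0 < b),
        abs_of_pos (by linarith : 0 < rightCoef y e n)]
      have := abs_sub (d n) (x n - c)
      have hb0 : 0 ≤ b := by linarith
      gcongr
      · linarith [hleft.1, hleft.2]
      · linarith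
    have h3 : |4 * (x n - c)| ≤ 4 * (27 / 100) ^ j := by
      rw [abs_mul, abs_of_pos (by norm_num : (0 : ℝ) < 4)]
      linarith [hleft.1]
    have h4 := abs_add_le (E * (e (n + 1) + κ * y (n + 1) - r₀) +
      b * ((d n - (x n - c)) * rightCoef y e n)) (4 * (x n - c))
    have h5 := abs_add_le (E * (e (n + 1) + κ * y (n + 1) - r₀))
      (b * ((d n - (x n - c)) * rightCoef y e n))
    linarith
  have hlim : ∀ η : ℝ, 0 < η → ∃ J : ℕ, ∀ n, IsMiddle n → J ≤ blockIndex n →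
      |b * ((2 + leftCoef x d n) * rightCoef y e n) - 4 * (z - x n - y (n + 1))| ≤ η := by
    intro η hη
    have hC : 0 < 2 * E + 2 * b + 4 := by linarith
    obtain ⟨J, hJ⟩ := exists_pow_lt_of_lt_one (div_pos hη hC) (by norm_num : (27 / 100 : ℝ) < 1)
    refine ⟨J, fun n hn hJn => (hest n hn).trans ?_⟩
    rw [← le_div_iff₀ hC]
    exact (pow_le_pow_of_le_one (by norm_num) (by norm_num) hJn).trans hJ.le
  have hdigit : ∀ n, IsMiddle n → (((blockDigit (fun _ => z) W n).1 : ℤ) : ℝ) = z := fun n hn => by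
    rw [blockDigit_middle hn]
  refine mem_spectrum_of_expansion h hx (upperB_expansion_eq h hx (by linarith) (fun n hn => ?_)
    (fun N₀ => ?_) fun η hη => ?_)
  · rw [hdigit n hn]; linarith
  · obtain ⟨n, hn, -, hjn⟩ := exists_isMiddle (j := N₀ + 1) (by omega)
    exact ⟨n, by omega, hn⟩
  · obtain ⟨J, hJ⟩ := hlim η hη
    refine ⟨J * J, fun n hn hsp => ?_⟩
    rw [hdigit n hsp]
    exact hJ n hsp (Nat.le_sqrt.2 (by omega))

lemma restricted_subset : restrictedThreeIntervalExchanges ⊆ threeIntervalExchanges := by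
  rintro L ⟨α, β, h1, h2, h3, h4, -, -, h5⟩
  exact ⟨α, β, h1, h2, h3, h4, h5⟩

lemma upperBLSpectrum_mono {A : Type*} [MeasurableSpace A] {F G : Set (Language A)} (h : F ⊆ G) :
    upperBLSpectrum F ⊆ upperBLSpectrum G := by
  rintro b ⟨L, hL, hb⟩
  exact ⟨L, h hL, hb⟩

theorem Icc_subset_restricted : Icc (ENNReal.ofReal (12 + 2 * √2)) ⊤ ⊆
    upperBLSpectrum restrictedThreeIntervalExchanges := by
  rintro b ⟨hb, -⟩
  rcases eq_or_ne b ⊤ with rfl | hb'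
  · exact top_mem_spectrum
  · rw [← ENNReal.ofReal_toReal hb']
    exact ofReal_mem_spectrum ((ENNReal.ofReal_le_iff_le_toReal hb').1 hb)

end BL

theorem mainTheorem5 :
    Set.Icc (ENNReal.ofReal (12 + 2 * Real.sqrt 2)) ⊤ ⊆
        BL.upperBLSpectrum BL.threeIntervalExchanges ∧
      Set.Icc (ENNReal.ofReal (12 + 2 * Real.sqrt 2)) ⊤ ⊆
        BL.upperBLSpectrum BL.restrictedThreeIntervalExchanges :=
  ⟨BL.Icc_subset_restricted.trans (BL.upperBLSpectrum_mono BL.restricted_subset),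
    BL.Icc_subset_restricted⟩
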